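/- Let $C$ be a group and $(B,\xi)$ a $C$-module. Let $\mathsf{OpExt}(C,B,\xi)$ be the groupoid of group extensions $E\colon 0\to B\xrightarrow{\kappa}E\xrightarrow{\gamma}C\to 0$ in which conjugation induces the action $\xi$, with morphisms the homomorphisms inducing the identity on $B$ and on $C$; let $\pi_0(\mathcal H^2(C,B,\xi))$ be its set of connected components, with the group structure given by the Baer sum. A crossed extension of $C$ is a crossed module $\partial\colon E_2\to E_1$ with an exact sequence $0\to B'\xrightarrow{j}E_2\xrightarrow{\partial}E_1\xrightarrow{p}C\to 0$; its kernel $B'$ is then a $C$-module. A butterfly from $(j,\partial,p)$ to $(j',\partial',p')$ consists of a group $F$ and homomorphisms $\kappa\colon E_2\to F$, $\iota\colon E_2'\to F$, $\delta\colon F\to E_1$, $\gamma\colon F\to E_1'$ such that $\delta\kappa=\partial$, $\gamma\iota=\partial'$, $p\delta=p'\gamma$, $\gamma\kappa=0$, the sequence $0\to E_2'\xrightarrow{\iota}F\xrightarrow{\delta}E_1\to 0$ is exact, and $\kappa(\delta(f)\ast x)=f+\kappa(x)-f$, $\iota(\gamma(f)\ast x')=f+\iota(x')-f$ for all $f\in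 F$, $x\in E_2$, $x'\in E_2'$. It induces a $C$-module morphism $\beta$ between the kernels, determined by $\kappa j=-\iota j'\beta$. Let $[\mathsf{BExt}](C)$ be the category of crossed extensions of $C$ and isomorphism classes of butterflies; the composite of butterflies with centres $F$ and $F'$ has as centre the cokernel of $\langle\iota,\kappa'\rangle\colon E_2'\to F\times_{E_1'}F'$. Let $\mathcal H^3(C,B,\xi)$ be the fibre over $(B,\xi)$ of the functor $[\mathsf{BExt}](C)\to\mathsf{Mod}(C)$ sending a crossed extension to its kernel and the class of a butterfly to $\beta$. Let $I_\xi$ be its unit object $0\to B=B\xrightarrow{0}C=C\to 0$ and $\pi_1(\mathcal H^3(C,B,\xi))$ the group of automorphisms of $I_\xi$ in $\mathcal H^3(C,B,\xi)$. Let $\mathsf{Eq}(I_\xi)$ be the groupoid of butterflies $I_\xi\to I_\xi$ with $\beta=1_B$ and their isomorphisms, and let $\Phi\colon\mathsf{OpExt}(C,B,\xi)\to\mathsf{Eq}(I_\xi)$ be the functor sending $(\kappa,\gamma)$ to the butterfly with centre $E$ and legs $-\kappa,\kappa$ (from $B$) and $\gamma,\gamma$ (to $C$). Then the group $\pi_1(\mathcal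 H^3(C,B,\xi))$ is abelian; sending a butterfly to its isomorphism class gives a bijection $\pi_0(\mathsf{Eq}(I_\xi))\to\pi_1(\mathcal H^3(C,B,\xi))$, and its composite with $\pi_0(\Phi)$ is an isomorphism of groups $$\pi_0(\mathcal H^2(C,B,\xi))\;\cong\;\pi_1(\mathcal H^3(C,B,\xi)).$$ Moreover both groups are isomorphic to the usual second cohomology group $H^2(C,B,\xi)$. -/

import Mathlib

open CategoryTheory

universe u

noncomputable section

namespace CohTwoGroup

/-! ### Auxiliary facts on groups -/

section Aux

variable {A B G N T : Type*} [Group A] [Group B] [Group G] [Group N] [Group T]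

/-- The pullback `A ×_G B` of two group homomorphisms, as a subgroup of `A × B`. -/
def pullback (f : A →* G) (g : B →* G) : Subgroup (A × B) :=
  (f.comp (MonoidHom.fst A B)).eqLocus (g.comp (MonoidHom.snd A B))

theorem mem_pullback {f : A →* G} {g : B →* G} {x : A × B} :
    x ∈ pullback f g ↔ f x.1 = g x.2 := Iff.rfl

/-- The homomorphism into a pullback with the given components. -/
def pair (f : A →* G) (g : B →* G) (a : T →* A) (b : T →* B) (h : ∀ t, f (a t) = g (b t)) :
    T →* pullback f g where
  toFun t := ⟨(a t, b t), h t⟩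
  map_one' := Subtype.ext (Prod.ext (map_one a) (map_one b))
  map_mul' x y := Subtype.ext (Prod.ext (map_mul a x y) (map_mul b x y))

/-- The first projection of a pullback. -/
def pr₁ (f : A →* G) (g : B →* G) : pullback f g →* A :=
  (MonoidHom.fst A B).comp (Subgroup.subtype _)

/-- The second projection of a pullback. -/
def pr₂ (f : A →* G) (g : B →* G) : pullback f g →* B :=
  (MonoidHom.snd A B).comp (Subgroup.subtype _)

/-- The short five lemma for group extensions. -/
theorem short_five {i : N →* A} {p : A →* G} {i' : N →* B} {p' : B →* G} (f : A →* B)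
    (hp : Function.Surjective p) (hk : ∀ a, p a = 1 → ∃ n, i n = a)
    (hi' : Function.Injective i') (hk' : ∀ b, p' b = 1 → ∃ n, i' n = b)
    (hi : ∀ n, f (i n) = i' n) (hpf : ∀ a, p' (f a) = p a) : Function.Bijective f := by
  constructor
  · rw [injective_iff_map_eq_one]
    intro a ha
    obtain ⟨n, rfl⟩ := hk a (by rw [← hpf, ha, map_one])
    rw [hi] at ha
    rw [(injective_iff_map_eq_one i').1 hi' n ha, map_one]
  · intro b
    obtain ⟨a, ha⟩ := hp (p' b)
    obtain ⟨n, hn⟩ := hk' ((f a)⁻¹ * b) (by rw [map_mul, map_inv, hpf, ha, inv_mul_cancel])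
    exact ⟨a * i n, by rw [map_mul, hi, hn, mul_inv_cancel_left]⟩

/-- A homomorphism descends along a surjective homomorphism whose kernel it kills. -/
theorem exists_descend (π : T →* A) (hπ : Function.Surjective π) (ψ : T →* B)
    (h : ∀ t, π t = 1 → ψ t = 1) : ∃ φ : A →* B, ∀ t, φ (π t) = ψ t := by
  refine ⟨π.liftOfSurjective hπ ⟨ψ, fun t ht => h t ht⟩, fun t => ?_⟩
  exact MonoidHom.liftOfRightInverse_comp_apply _ _ _ _ _

end Aux

/-! ### Abelian extensions and the Baer sum -/

section OpExt

variable {C : Type u} [Group C]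

/-- The action of `C` on the module `M`, on the multiplicative copy of `M`. -/
def modAct (M : Rep.{u} ℤ C) : C →* MulAut (Multiplicative M) where
  toFun c :=
    { toFun := fun b => Multiplicative.ofAdd (M.ρ c b.toAdd)
      invFun := fun b => Multiplicative.ofAdd (M.ρ c⁻¹ b.toAdd)
      left_inv := fun b => by simp
      right_inv := fun b => by simp
      map_mul' := fun b b' => by simp }
  map_one' := by ext b; simp
  map_mul' c d := by ext b; simp

theorem modAct_apply (M : Rep.{u} ℤ C) (c : C) (b : Multiplicative M) :
    modAct M c b = Multiplicative.ofAdd (M.ρ c b.toAdd) := rfl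

/-- An extension `0 → M → E → C → 0` of the group `C` by the `C`-module `M` such that conjugation
in `E` induces the given action of `C` on `M`. -/
structure OpExt (M : Rep.{u} ℤ C) where
  /-- the middle group -/
  carrier : Type u
  [group : Group carrier]
  /-- the short exact sequence -/
  ext : GroupExtension (Multiplicative M) carrier C
  conj : ∀ (e : carrier) (b : M),
    e * ext.inl (Multiplicative.ofAdd b) * e⁻¹ =
      ext.inl (Multiplicative.ofAdd (M.ρ (ext.rightHom e) b))

attribute [instance] OpExt.group

namespace OpExt

variable {M : Rep.{u} ℤ C}

/-- The inclusion of the kernel. -/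
abbrev κ (E : OpExt M) : Multiplicative M →* E.carrier := E.ext.inl

/-- The projection to `C`. -/
abbrev γ (E : OpExt M) : E.carrier →* C := E.ext.rightHom

theorem γ_κ (E : OpExt M) (b) : E.γ (E.κ b) = 1 := E.ext.rightHom_inl b

theorem exact (E : OpExt M) (e) (h : E.γ e = 1) : ∃ b, E.κ b = e := by
  have : e ∈ E.ext.inl.range := by rw [E.ext.range_inl_eq_ker_rightHom]; exact h
  exact this

theorem conj' (E : OpExt M) (e : E.carrier) (b : M) :
    e * E.κ (Multiplicative.ofAdd b) =
      E.κ (Multiplicative.ofAdd (M.ρ (E.γ e) b)) * e := by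
  rw [← E.conj, inv_mul_cancel_right]

theorem comm_of_γ (E : OpExt M) (e : E.carrier) (h : E.γ e = 1) (b : Multiplicative M) :
    e * E.κ b = E.κ b * e := by
  obtain ⟨b', rfl⟩ := E.exact e h
  rw [← map_mul, ← map_mul, mul_comm]

/-- Morphisms of extensions inducing the identity on `M` and on `C`. -/
@[ext]
structure Hom (E E' : OpExt M) where
  /-- the homomorphism between the middle groups -/
  hom : E.carrier →* E'.carrier
  hom_κ : ∀ b, hom (E.κ b) = E'.κ b
  γ_hom : ∀ e, E'.γ (hom e) = E.γ e

/-- The category `OpExt(C, M)`. -/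
instance : Category (OpExt M) where
  Hom := Hom
  id E := ⟨MonoidHom.id _, fun _ => rfl, fun _ => rfl⟩
  comp f g := ⟨g.hom.comp f.hom, fun b => by simp [f.hom_κ, g.hom_κ],
    fun e => by simp [f.γ_hom, g.γ_hom]⟩

theorem nonempty_hom_symm {E E' : OpExt M} (f : E ⟶ E') : Nonempty (E' ⟶ E) := by
  have hb : Function.Bijective f.hom := short_five f.hom E.ext.rightHom_surjective E.exact
    E'.ext.inl_injective E'.exact f.hom_κ f.γ_hom
  let g := MulEquiv.ofBijective f.hom hb
  exact ⟨⟨g.symm.toMonoidHom, fun b => by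
      change g.symm _ = _
      rw [MulEquiv.symm_apply_eq]; exact (f.hom_κ b).symm,
    fun e => by
      change E.γ (g.symm e) = _
      rw [← f.γ_hom]; exact congrArg E'.γ (g.apply_symm_apply e)⟩⟩

theorem zigzag_iff {E E' : OpExt M} : Zigzag E E' ↔ Nonempty (E ⟶ E') := by
  constructor
  · intro h
    induction h with
    | refl => exact ⟨𝟙 _⟩
    | tail _ h ih =>
      obtain ⟨f⟩ := ih
      rcases h with ⟨⟨g⟩⟩ | ⟨⟨g⟩⟩
      · exact ⟨f ≫ g⟩
      · obtain ⟨g'⟩ := nonempty_hom_symm g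
        exact ⟨f ≫ g'⟩
  · rintro ⟨f⟩
    exact Zigzag.of_hom f

/-- The split extension `M → M ⋊ C → C`. -/
def unit (M : Rep.{u} ℤ C) : OpExt M where
  carrier := Multiplicative M ⋊[modAct M] C
  ext := SemidirectProduct.toGroupExtension (modAct M)
  conj e b := by
    ext
    · change e.left * modAct M e.right (Multiplicative.ofAdd b) *
        modAct M (e.right * 1) (modAct M e.right⁻¹ e.left⁻¹) =
          modAct M e.right (Multiplicative.ofAdd b)
      rw [mul_one, map_inv (modAct M), MulAut.apply_inv_self, mul_inv_cancel_comm]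
    · simp [SemidirectProduct.toGroupExtension]

/-- The extension obtained from `E` by changing the sign of the inclusion of the kernel. -/
def neg (E : OpExt M) : OpExt M where
  carrier := E.carrier
  ext :=
    { inl := E.κ.comp (MonoidHom.id _)⁻¹
      rightHom := E.γ
      inl_injective := by
        intro a b h
        exact inv_injective (E.ext.inl_injective h)
      range_inl_eq_ker_rightHom := by
        ext e
        constructor
        · rintro ⟨b, rfl⟩
          exact E.γ_κ _
        · intro h
          obtain ⟨b, rfl⟩ := E.exact e h
          exact ⟨b⁻¹, by simp⟩
      rightHom_surjective := E.ext.rightHom_surjective }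
  conj e b := by
    have := E.conj e (-b)
    simpa using this

/-- The antidiagonal embedding `b ↦ (κ b, κ' (-b))` of `M` into `E ×_C E'`. -/
def antidiag (E E' : OpExt M) : Multiplicative M →* pullback E.γ E'.γ :=
  pair E.γ E'.γ E.κ (E'.κ.comp (MonoidHom.id _)⁻¹) fun _ => (E.γ_κ _).trans (E'.γ_κ _).symm

theorem antidiag_coe (E E' : OpExt M) (b : Multiplicative M) :
    (antidiag E E' b : E.carrier × E'.carrier) = (E.κ b, E'.κ b⁻¹) := rfl

instance antidiag_normal (E E' : OpExt M) : (antidiag E E').range.Normal := by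
  constructor
  rintro _ ⟨b, rfl⟩ ⟨⟨e, e'⟩, h⟩
  rw [mem_pullback] at h
  refine ⟨Multiplicative.ofAdd (M.ρ (E.γ e) b.toAdd), ?_⟩
  apply Subtype.ext
  apply Prod.ext
  · exact (E.conj e b.toAdd).symm
  · have := E'.conj e' (-b.toAdd)
    change E.γ e = E'.γ e' at h
    change _ = E'.κ (modAct M (E'.γ e') b⁻¹) at this
    rw [← h, map_inv (modAct M (E.γ e))] at this
    exact this.symm

/-- The underlying group of the Baer sum: the quotient of `E ×_C E'` by the antidiagonal copy
of `M`. -/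
abbrev BaerCarrier (E E' : OpExt M) : Type u := pullback E.γ E'.γ ⧸ (antidiag E E').range

/-- The class of a pair in the Baer sum. -/
def baerMk (E E' : OpExt M) : pullback E.γ E'.γ →* BaerCarrier E E' := QuotientGroup.mk' _

theorem baerMk_surjective (E E' : OpExt M) : Function.Surjective (baerMk E E') :=
  QuotientGroup.mk'_surjective _

theorem baerMk_eq_one {E E' : OpExt M} {x : pullback E.γ E'.γ} :
    baerMk E E' x = 1 ↔ ∃ b, E.κ b = x.1.1 ∧ E'.κ b⁻¹ = x.1.2 := by
  rw [baerMk, QuotientGroup.mk'_apply, QuotientGroup.eq_one_iff]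
  constructor
  · rintro ⟨b, rfl⟩
    exact ⟨b, rfl, rfl⟩
  · rintro ⟨b, h, h'⟩
    exact ⟨b, Subtype.ext (Prod.ext h h')⟩

/-- The homomorphism `b ↦ (0, κ' b)` from `M` to `E ×_C E'`. -/
def inr (E E' : OpExt M) : Multiplicative M →* pullback E.γ E'.γ :=
  pair E.γ E'.γ 1 E'.κ fun _ => (map_one E.γ).trans (E'.γ_κ _).symm

/-- The projection `E ×_C E' → C`. -/
def toBase (E E' : OpExt M) : pullback E.γ E'.γ →* C :=
  E.γ.comp (pr₁ _ _)

/-- The Baer sum of two extensions: pull back along the diagonal of `C`, then push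
forward along the codiagonal of `M`. -/
def baer (E E' : OpExt M) : OpExt M where
  carrier := BaerCarrier E E'
  ext :=
    { inl := (baerMk E E').comp (inr E E')
      rightHom := QuotientGroup.lift _ (toBase E E') (by
        rintro _ ⟨b, rfl⟩
        exact E.γ_κ b)
      inl_injective := by
        rw [injective_iff_map_eq_one]
        intro b h
        obtain ⟨b', h1, h2⟩ := baerMk_eq_one.1 h
        have h1' : b' = 1 := E.ext.inl_injective (h1.trans (map_one E.κ).symm)
        subst h1'
        have h2' : E'.κ 1⁻¹ = E'.κ b := h2
        exact (E'.ext.inl_injective (by simpa using h2')).symm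
      range_inl_eq_ker_rightHom := by
        ext x
        obtain ⟨⟨⟨e, e'⟩, h⟩, rfl⟩ := baerMk_surjective E E' x
        constructor
        · rintro ⟨b, hb⟩
          rw [← hb]
          exact map_one E.γ
        · intro hx
          have he : E.γ e = 1 := hx
          obtain ⟨b, rfl⟩ := E.exact e he
          obtain ⟨b', rfl⟩ := E'.exact e' (by rw [← he]; exact h.symm)
          refine ⟨b' * b, ?_⟩
          rw [MonoidHom.comp_apply, ← inv_mul_eq_one, ← map_inv, ← map_mul, baerMk_eq_one]
          refine ⟨b, ?_, ?_⟩
          · change _ = (1 : E.carrier)⁻¹ * E.κ b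
            simp
          · change _ = (E'.κ (b' * b))⁻¹ * E'.κ b'
            rw [← map_inv, ← map_mul]
            congr 1
            simp
      rightHom_surjective := by
        intro c
        obtain ⟨e, rfl⟩ := E.ext.rightHom_surjective c
        obtain ⟨e', he'⟩ := E'.ext.rightHom_surjective (E.γ e)
        exact ⟨baerMk E E' ⟨(e, e'), he'.symm⟩, rfl⟩ }
  conj x b := by
    obtain ⟨⟨⟨e, e'⟩, h⟩, rfl⟩ := baerMk_surjective E E' x
    change baerMk E E' _ * baerMk E E' _ * (baerMk E E' _)⁻¹ = baerMk E E' _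
    rw [← map_inv, ← map_mul, ← map_mul]
    congr 1
    apply Subtype.ext
    apply Prod.ext
    · change e * 1 * e⁻¹ = 1
      simp
    · have h' : E.γ e = E'.γ e' := h
      change e' * E'.κ _ * e'⁻¹ = E'.κ (Multiplicative.ofAdd (M.ρ (E.γ e) b))
      rw [h']
      exact E'.conj e' b

/-- Constructing a morphism out of a Baer sum. -/
theorem nonempty_hom_of {E E' X : OpExt M} (φ : pullback E.γ E'.γ →* X.carrier)
    (h1 : ∀ b, φ (antidiag E E' b) = 1) (h2 : ∀ b, φ (inr E E' b) = X.κ b)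
    (h3 : ∀ x, X.γ (φ x) = toBase E E' x) : Nonempty (baer E E' ⟶ X) := by
  obtain ⟨f, hf⟩ := exists_descend (baerMk E E') (baerMk_surjective E E') φ (by
    intro x hx
    obtain ⟨b, hb1, hb2⟩ := baerMk_eq_one.1 hx
    rw [← h1 b]
    congr 1
    exact Subtype.ext (Prod.ext hb1.symm hb2.symm))
  refine ⟨⟨f, fun b => (hf _).trans (h2 b), fun x => ?_⟩⟩
  obtain ⟨x, rfl⟩ := baerMk_surjective E E' x
  exact (congrArg X.γ (hf x)).trans (h3 x)

theorem baer_map {E₁ E₁' E₂ E₂' : OpExt M} (f : E₁ ⟶ E₁') (g : E₂ ⟶ E₂') :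
    Nonempty (baer E₁ E₂ ⟶ baer E₁' E₂') := by
  let ψ : pullback E₁.γ E₂.γ →* pullback E₁'.γ E₂'.γ :=
    pair E₁'.γ E₂'.γ (f.hom.comp (pr₁ _ _)) (g.hom.comp (pr₂ _ _)) fun x =>
      (f.γ_hom _).trans (Eq.trans x.2 (g.γ_hom _).symm)
  refine nonempty_hom_of ((baerMk E₁' E₂').comp ψ) (fun b => ?_) (fun b => ?_) (fun x => ?_)
  · exact baerMk_eq_one.2 ⟨b, (f.hom_κ b).symm, (g.hom_κ _).symm⟩
  · refine congrArg (baerMk E₁' E₂') (Subtype.ext (Prod.ext ?_ ?_))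
    · exact map_one f.hom
    · exact g.hom_κ b
  · exact f.γ_hom _

theorem baer_comm (E E' : OpExt M) : Nonempty (baer E E' ⟶ baer E' E) := by
  let ψ : pullback E.γ E'.γ →* pullback E'.γ E.γ :=
    pair E'.γ E.γ (pr₂ _ _) (pr₁ _ _) fun x => Eq.symm x.2
  refine nonempty_hom_of ((baerMk E' E).comp ψ) (fun b => ?_) (fun b => ?_) (fun x => ?_)
  · refine baerMk_eq_one.2 ⟨b⁻¹, rfl, ?_⟩
    rw [inv_inv]; rfl
  · change baerMk E' E _ = baerMk E' E _
    rw [← inv_mul_eq_one, ← map_inv, ← map_mul, baerMk_eq_one]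
    refine ⟨b⁻¹, ?_, ?_⟩
    · change _ = (E'.κ b)⁻¹ * 1
      simp
    · change _ = (1 : E.carrier)⁻¹ * E.κ b
      simp
  · exact Eq.symm x.2

theorem baer_unit (E : OpExt M) : Nonempty (baer E (unit M) ⟶ E) := by
  let φ : pullback E.γ (unit M).γ →* E.carrier :=
    MonoidHom.mk' (fun x => E.κ x.1.2.left * x.1.1) (by
      rintro ⟨⟨e, ⟨b, c⟩⟩, h⟩ ⟨⟨e', ⟨b', c'⟩⟩, h'⟩
      have hc : E.γ e = c := h
      subst hc
      change E.κ (b * modAct M (E.γ e) b') * (e * e') = E.κ b * e * (E.κ b' * e')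
      have := E.conj' e b'.toAdd
      rw [map_mul, mul_assoc, mul_assoc, ← mul_assoc e, modAct_apply]
      erw [this]
      simp only [mul_assoc])
  refine nonempty_hom_of φ (fun b => ?_) (fun b => ?_) (fun x => ?_)
  · change E.κ b⁻¹ * E.κ b = 1
    simp
  · change E.κ b * 1 = _
    simp
  · change E.γ (E.κ _ * _) = _
    rw [map_mul, γ_κ, one_mul]; rfl

/-- The embedding of the kernel composed with `e e'⁻¹` for `e, e'` over the same element. -/
theorem exists_diff (E : OpExt M) (e e' : E.carrier) (h : E.γ e = E.γ e') :
    ∃ b, E.κ b = e * e'⁻¹ := E.exact _ (by rw [map_mul, map_inv, h, mul_inv_cancel])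

theorem baer_neg (E : OpExt M) : Nonempty (baer E (neg E) ⟶ unit M) := by
  choose d₀ hd₀ using E.exists_diff
  let d : pullback E.γ (neg E).γ → Multiplicative M := fun x => d₀ x.1.1 x.1.2 x.2
  have hd : ∀ x, E.κ (d x) = _ := fun x => hd₀ x.1.1 x.1.2 x.2
  let φ : pullback E.γ (neg E).γ →* (unit M).carrier :=
    MonoidHom.mk' (fun x => (⟨d x, E.γ x.1.1⟩ : Multiplicative M ⋊[modAct M] C)) (by
      intro x y
      refine SemidirectProduct.ext ?_ (map_mul E.γ _ _)
      apply E.ext.inl_injective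
      change E.κ _ = E.κ (d x * modAct M (E.γ x.1.1) (d y))
      rw [hd, map_mul, hd]
      have := E.conj x.1.1 (d y).toAdd
      have h2 : E.κ (modAct M (E.γ x.1.1) (d y)) = x.1.1 * E.κ (d y) * x.1.1⁻¹ := this.symm
      rw [h2, hd]
      obtain ⟨⟨e, e₀⟩, h⟩ := x
      obtain ⟨⟨f, f₀⟩, h'⟩ := y
      obtain ⟨e', he'⟩ : ∃ e' : E.carrier, e' = e₀ := ⟨e₀, rfl⟩
      obtain ⟨f', hf'⟩ : ∃ f' : E.carrier, f' = f₀ := ⟨f₀, rfl⟩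
      subst he' hf'
      obtain ⟨b, hb⟩ := E.exists_diff e e' h
      obtain ⟨b', hb'⟩ := E.exists_diff f f' h'
      obtain rfl : e = E.κ b * e' := by rw [hb, inv_mul_cancel_right]
      obtain rfl : f = E.κ b' * f' := by rw [hb', inv_mul_cancel_right]
      change E.κ b * e' * (E.κ b' * f') * ((e' * f' : E.carrier))⁻¹ =
        E.κ b * e' * (e' : E.carrier)⁻¹ *
          (E.κ b * e' * (E.κ b' * f' * (f' : E.carrier)⁻¹) * (E.κ b * e')⁻¹)
      have h3 := E.conj' e' b'.toAdd
      have h4 : e' * E.κ b' = E.κ (modAct M (E.γ e') b') * e' := h3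
      have h5 : E.κ b * E.κ (modAct M (E.γ e') b') = E.κ (modAct M (E.γ e') b') * E.κ b := by
        rw [← map_mul, ← map_mul, mul_comm]
      have e1 : E.κ b * e' * (E.κ b' * f') * ((e' * f' : E.carrier))⁻¹ =
        E.κ b * (e' * E.κ b') * (e' : E.carrier)⁻¹ := by group
      have e2 : E.κ b * e' * (e' : E.carrier)⁻¹ *
          (E.κ b * e' * (E.κ b' * f' * (f' : E.carrier)⁻¹) * (E.κ b * e')⁻¹) =
          E.κ b * E.κ b * (e' * E.κ b') * (e' : E.carrier)⁻¹ * (E.κ b)⁻¹ := by group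
      rw [e1, e2, h4, mul_assoc (E.κ b), mul_inv_cancel_right, mul_assoc (E.κ b * E.κ b),
        mul_inv_cancel_right, mul_assoc (E.κ b) (E.κ b), h5]
      group
      exact h5.symm)
  refine nonempty_hom_of φ (fun b => ?_) (fun b => ?_) (fun x => ?_)
  · refine SemidirectProduct.ext ?_ (E.γ_κ b)
    apply E.ext.inl_injective
    refine (hd _).trans (Eq.trans ?_ (map_one E.κ).symm)
    change E.κ b * (E.κ (b⁻¹)⁻¹)⁻¹ = 1
    simp
  · refine SemidirectProduct.ext ?_ (map_one E.γ)
    apply E.ext.inl_injective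
    refine (hd _).trans ?_
    change 1 * (E.κ b⁻¹)⁻¹ = E.κ b
    simp
  · rfl

theorem baer_assoc (E₁ E₂ E₃ : OpExt M) :
    Nonempty (baer (baer E₁ E₂) E₃ ⟶ baer E₁ (baer E₂ E₃)) := by
  let T := pullback (toBase E₁ E₂) E₃.γ
  let π : T →* pullback (baer E₁ E₂).γ E₃.γ :=
    pair (baer E₁ E₂).γ E₃.γ ((baerMk E₁ E₂).comp (pr₁ _ _)) (pr₂ _ _) fun x => x.2
  have hπ : Function.Surjective π := by
    rintro ⟨⟨x, e₃⟩, h⟩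
    obtain ⟨x, rfl⟩ := baerMk_surjective E₁ E₂ x
    exact ⟨⟨(x, e₃), h⟩, rfl⟩
  let ρ₀ : T →* pullback E₂.γ E₃.γ :=
    pair E₂.γ E₃.γ ((pr₂ _ _).comp (pr₁ _ _)) (pr₂ _ _) fun x => (Eq.symm x.1.1.2).trans x.2
  let ρ : T →* pullback E₁.γ (baer E₂ E₃).γ :=
    pair E₁.γ (baer E₂ E₃).γ ((pr₁ _ _).comp (pr₁ _ _)) ((baerMk E₂ E₃).comp ρ₀)
      fun x => x.1.1.2
  obtain ⟨φ, hφ⟩ := exists_descend ((baerMk (baer E₁ E₂) E₃).comp π)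
    ((baerMk_surjective _ _).comp hπ) ((baerMk E₁ (baer E₂ E₃)).comp ρ) (by
      rintro ⟨⟨⟨⟨e₁, e₂⟩, h₁₂⟩, e₃⟩, h₃⟩ ht
      obtain ⟨b, hb, hb'⟩ := baerMk_eq_one.1 ht
      have hb1 : baerMk E₁ E₂ (inr E₁ E₂ b) = baerMk E₁ E₂ ⟨(e₁, e₂), h₁₂⟩ := hb
      rw [← inv_mul_eq_one, ← map_inv, ← map_mul, baerMk_eq_one] at hb1
      obtain ⟨a, ha1, ha2⟩ := hb1
      have ha1' : E₁.κ a = 1⁻¹ * e₁ := ha1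
      have ha2' : E₂.κ a⁻¹ = (E₂.κ b)⁻¹ * e₂ := ha2
      have hb3 : E₃.κ b⁻¹ = e₃ := hb'
      refine baerMk_eq_one.2 ⟨a, by rw [ha1', inv_one, one_mul]; rfl, ?_⟩
      change baerMk E₂ E₃ (inr E₂ E₃ a⁻¹) = baerMk E₂ E₃ (ρ₀ _)
      rw [← inv_mul_eq_one, ← map_inv, ← map_mul, baerMk_eq_one]
      refine ⟨b * a⁻¹, ?_, ?_⟩
      · change _ = (1 : E₂.carrier)⁻¹ * e₂
        rw [map_mul, ha2']; group
      · change _ = (E₃.κ a⁻¹)⁻¹ * e₃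
        rw [← hb3, ← map_inv, ← map_mul]
        congr 1
        simp)
  have hs : Function.Surjective ((baerMk (baer E₁ E₂) E₃).comp π) :=
    (baerMk_surjective _ _).comp hπ
  refine ⟨⟨φ, fun b => ?_, fun x => ?_⟩⟩
  · refine (hφ ⟨(1, E₃.κ b), ?_⟩).trans ?_
    · rw [mem_pullback]; simp
    · refine congrArg (baerMk E₁ (baer E₂ E₃)) (Subtype.ext (Prod.ext rfl ?_))
      rfl
  · obtain ⟨t, rfl⟩ := hs x
    exact congrArg (baer E₁ (baer E₂ E₃)).γ (hφ t)

end OpExt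

open OpExt

variable {M : Rep.{u} ℤ C}

/-- The set of connected components of `OpExt(C, M)`. -/
abbrev Pi₀ (M : Rep.{u} ℤ C) : Type (u + 1) := CategoryTheory.ConnectedComponents (OpExt M)

/-- The Baer sum on connected components. -/
instance : Add (Pi₀ M) where
  add := Quotient.map₂ baer fun _ _ h _ _ h' => by
    obtain ⟨f⟩ := zigzag_iff.1 h
    obtain ⟨g⟩ := zigzag_iff.1 h'
    exact zigzag_iff.2 (baer_map f g)

instance : Zero (Pi₀ M) where
  zero := CategoryTheory.ConnectedComponents.mk (unit M)

instance : Neg (Pi₀ M) where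
  neg := Quotient.map neg fun E E' h => by
    obtain ⟨f⟩ := zigzag_iff.1 h
    exact zigzag_iff.2 ⟨⟨f.hom, fun b => f.hom_κ b⁻¹, f.γ_hom⟩⟩

theorem mk_add_mk (E E' : OpExt M) :
    CategoryTheory.ConnectedComponents.mk E + CategoryTheory.ConnectedComponents.mk E' = CategoryTheory.ConnectedComponents.mk (baer E E') :=
  rfl

theorem mk_eq_of_hom {E E' : OpExt M} (h : Nonempty (E ⟶ E')) :
    CategoryTheory.ConnectedComponents.mk E = CategoryTheory.ConnectedComponents.mk E' := Quotient.sound (zigzag_iff.2 h)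

/-- The abelian group `π₀` of the 2-group of extensions of `C` by `M`: connected components of
extensions, added by Baer sum. -/
instance : AddCommGroup (Pi₀ M) :=
  have hc : ∀ x y : Pi₀ M, x + y = y + x := by
    rintro ⟨E⟩ ⟨E'⟩; exact mk_eq_of_hom (baer_comm E E')
  have hz : ∀ x : Pi₀ M, x + 0 = x := by
    rintro ⟨E⟩; exact mk_eq_of_hom (baer_unit E)
  have hn : ∀ x : Pi₀ M, x + -x = 0 := by
    rintro ⟨E⟩; exact mk_eq_of_hom (baer_neg E)
  { add_assoc := by rintro ⟨E⟩ ⟨E'⟩ ⟨E''⟩; exact mk_eq_of_hom (baer_assoc E E' E'')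
    zero_add := fun x => (hc 0 x).trans (hz x)
    add_zero := hz
    neg_add_cancel := fun x => (hc (-x) x).trans (hn x)
    add_comm := hc
    nsmul := nsmulRec
    zsmul := zsmulRec }

end OpExt

/-! ### Morphisms of modules -/

section RepAux

variable {k : Type*} {G : Type*} [CommRing k] [Group G] {M N : Rep.{u} k G}

/-- The morphism of representations with the given underlying additive map. -/
def repHom (f : M →+ N) (hs : ∀ (r : k) (m : M), f (r • m) = r • f m)
    (hρ : ∀ (g : G) (m : M), f (M.ρ g m) = N.ρ g (f m)) : M ⟶ N :=
  ConcreteCategory.ofHom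
    { toFun := f
      map_add' := map_add f
      map_smul' := hs
      isIntertwining' := fun g => LinearMap.ext fun m => hρ g m }

theorem repHom_apply (f : M →+ N) (hs) (hρ) (m : M) : repHom f hs hρ m = f m := rfl

theorem rep_ext {f g : M ⟶ N} (h : ∀ m, f m = g m) : f = g :=
  Rep.hom_ext (Representation.IntertwiningMap.ext (LinearMap.ext h))

end RepAux

/-! ### Crossed extensions and butterflies -/

/-- A crossed extension `0 → B → E₂ → E₁ → C → 0` of the group `C`: a crossed module `E₂ → E₁` with
kernel `B` and cokernel `C`. The kernel is recorded together with the `C`-module structure that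
the action of `E₁` on `E₂` induces on it. -/
structure CrossedExtension (C : Type u) [Group C] where
  /-- the kernel, as a `C`-module -/
  mod : Rep.{u} ℤ C
  /-- the source of the crossed module -/
  E₂ : Type u
  /-- the target of the crossed module -/
  E₁ : Type u
  [group₂ : Group E₂]
  [group₁ : Group E₁]
  /-- the action of `E₁` on `E₂` -/
  act : E₁ →* MulAut E₂
  /-- the kernel inclusion -/
  j : Multiplicative mod →* E₂
  /-- the boundary of the crossed module -/
  bd : E₂ →* E₁
  /-- the cokernel projection -/
  p : E₁ →* C
  bd_act : ∀ g x, bd (act g x) = g * bd x * g⁻¹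
  peiffer : ∀ x y, act (bd x) y = x * y * x⁻¹
  j_injective : Function.Injective j
  bd_eq_one_iff : ∀ x, bd x = 1 ↔ ∃ b, j b = x
  p_eq_one_iff : ∀ g, p g = 1 ↔ ∃ x, bd x = g
  p_surjective : Function.Surjective p
  act_j : ∀ g b, act g (j b) = j (modAct mod (p g) b)

attribute [instance] CrossedExtension.group₂ CrossedExtension.group₁

variable {C : Type u} [Group C]

namespace CrossedExtension

theorem bd_j (E : CrossedExtension C) (b) : E.bd (E.j b) = 1 := (E.bd_eq_one_iff _).2 ⟨b, rfl⟩

/-- The crossed extension `I : 0 → M = M → C = C → 0` with trivial boundary. -/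
def unit (M : Rep.{u} ℤ C) : CrossedExtension C where
  mod := M
  E₂ := Multiplicative M
  E₁ := C
  act := modAct M
  j := MonoidHom.id _
  bd := 1
  p := MonoidHom.id _
  bd_act g x := by simp
  peiffer x y := by simp
  j_injective := Function.injective_id
  bd_eq_one_iff x := by simp
  p_eq_one_iff g := by simp [eq_comm]
  p_surjective := Function.surjective_id
  act_j g b := rfl

end CrossedExtension

open CrossedExtension

/-- A butterfly between two crossed extensions of `C`. -/
structure Butterfly (E E' : CrossedExtension C) where
  /-- the group in the centre of the butterfly -/
  carrier : Type u
  [group : Group carrier]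
  κ : E.E₂ →* carrier
  ι : E'.E₂ →* carrier
  δ : carrier →* E.E₁
  γ : carrier →* E'.E₁
  δ_κ : ∀ x, δ (κ x) = E.bd x
  γ_ι : ∀ x, γ (ι x) = E'.bd x
  p_δ : ∀ f, E.p (δ f) = E'.p (γ f)
  γ_κ : ∀ x, γ (κ x) = 1
  ι_injective : Function.Injective ι
  δ_eq_one_iff : ∀ f, δ f = 1 ↔ ∃ x, ι x = f
  δ_surjective : Function.Surjective δ
  κ_act : ∀ f x, κ (E.act (δ f) x) = f * κ x * f⁻¹
  ι_act : ∀ f x, ι (E'.act (γ f) x) = f * ι x * f⁻¹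

attribute [instance] Butterfly.group

namespace Butterfly

variable {E E' E'' E''' : CrossedExtension C}

theorem δ_ι (F : Butterfly E E') (x) : F.δ (F.ι x) = 1 := (F.δ_eq_one_iff _).2 ⟨x, rfl⟩

/-- Isomorphisms of butterflies. -/
@[ext]
structure Iso (F G : Butterfly E E') where
  /-- the isomorphism between the central groups -/
  equiv : F.carrier ≃* G.carrier
  equiv_ι : ∀ x, equiv (F.ι x) = G.ι x
  equiv_κ : ∀ x, equiv (F.κ x) = G.κ x
  γ_equiv : ∀ f, G.γ (equiv f) = F.γ f
  δ_equiv : ∀ f, G.δ (equiv f) = F.δ f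

/-- Butterflies between two fixed crossed extensions form a category, with the isomorphisms of
butterflies as arrows. -/
instance : Category (Butterfly E E') where
  Hom := Iso
  id F := ⟨MulEquiv.refl _, fun _ => rfl, fun _ => rfl, fun _ => rfl, fun _ => rfl⟩
  comp f g := ⟨f.equiv.trans g.equiv, fun x => by simp [f.equiv_ι, g.equiv_ι],
    fun x => by simp [f.equiv_κ, g.equiv_κ], fun x => by simp [f.γ_equiv, g.γ_equiv],
    fun x => by simp [f.δ_equiv, g.δ_equiv]⟩

/-- The inverse of an isomorphism of butterflies. -/
def Iso.symm {F G : Butterfly E E'} (f : Iso F G) : Iso G F where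
  equiv := f.equiv.symm
  equiv_ι x := by rw [MulEquiv.symm_apply_eq, f.equiv_ι]
  equiv_κ x := by rw [MulEquiv.symm_apply_eq, f.equiv_κ]
  γ_equiv x := by rw [← f.γ_equiv, MulEquiv.apply_symm_apply]
  δ_equiv x := by rw [← f.δ_equiv, MulEquiv.apply_symm_apply]

/-- A homomorphism of butterflies is an isomorphism. -/
def Iso.ofHom {F G : Butterfly E E'} (f : F.carrier →* G.carrier)
    (hι : ∀ x, f (F.ι x) = G.ι x) (hκ : ∀ x, f (F.κ x) = G.κ x)
    (hγ : ∀ x, G.γ (f x) = F.γ x) (hδ : ∀ x, G.δ (f x) = F.δ x) : Iso F G where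
  equiv := MulEquiv.ofBijective f (short_five f F.δ_surjective
    (fun a h => (F.δ_eq_one_iff a).1 h) G.ι_injective (fun a h => (G.δ_eq_one_iff a).1 h) hι hδ)
  equiv_ι := hι
  equiv_κ := hκ
  γ_equiv := hγ
  δ_equiv := hδ

/-- The relation of being isomorphic. -/
instance setoid (E E' : CrossedExtension C) : Setoid (Butterfly E E') where
  r F G := Nonempty (Iso F G)
  iseqv :=
    { refl := fun F => ⟨𝟙 F⟩
      symm := fun ⟨f⟩ => ⟨f.symm⟩
      trans := fun ⟨f⟩ ⟨g⟩ => ⟨CategoryStruct.comp (obj := Butterfly E E') f g⟩ }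

/-- The identity butterfly, with central group `E₂ ⋊ E₁`. -/
def id (E : CrossedExtension C) : Butterfly E E where
  carrier := E.E₂ ⋊[E.act] E.E₁
  κ := MonoidHom.mk' (fun x => ⟨x⁻¹, E.bd x⟩) (by
    intro x y
    refine SemidirectProduct.ext ?_ (map_mul E.bd x y)
    change (x * y)⁻¹ = x⁻¹ * E.act (E.bd x) y⁻¹
    rw [E.peiffer]; group)
  ι := SemidirectProduct.inl
  δ := SemidirectProduct.rightHom
  γ := MonoidHom.mk' (fun f => E.bd f.left * f.right) (by
    intro f g
    change E.bd (f.left * E.act f.right g.left) * (f.right * g.right) = _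
    rw [map_mul, E.bd_act]; group)
  δ_κ x := rfl
  γ_ι x := mul_one _
  p_δ f := by
    change E.p f.right = E.p (E.bd f.left * f.right)
    rw [map_mul, (E.p_eq_one_iff (E.bd f.left)).2 ⟨_, rfl⟩, one_mul]
  γ_κ x := by
    change E.bd x⁻¹ * E.bd x = 1
    rw [← map_mul, inv_mul_cancel, map_one]
  ι_injective := SemidirectProduct.inl_injective
  δ_eq_one_iff f := by
    constructor
    · intro h
      exact ⟨f.left, SemidirectProduct.ext rfl (Eq.symm h)⟩
    · rintro ⟨x, rfl⟩
      rfl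
  δ_surjective := SemidirectProduct.rightHom_surjective
  κ_act f x := by
    rw [eq_mul_inv_iff_mul_eq]
    refine SemidirectProduct.ext ?_ ?_
    · change (E.act f.right x)⁻¹ * E.act (E.bd (E.act f.right x)) f.left =
        f.left * E.act f.right x⁻¹
      rw [E.peiffer, map_inv]; group
    · change E.bd (E.act f.right x) * f.right = f.right * E.bd x
      rw [E.bd_act]; group
  ι_act f x := by
    rw [eq_mul_inv_iff_mul_eq]
    refine SemidirectProduct.ext ?_ ?_
    · change E.act (E.bd f.left * f.right) x * E.act 1 f.left = f.left * E.act f.right x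
      rw [map_mul, map_one]
      change E.act (E.bd f.left) (E.act f.right x) * f.left = _
      rw [E.peiffer]; group
    · change 1 * f.right = f.right * 1
      simp

/-! #### Composition of butterflies -/

section comp

variable (F : Butterfly E E') (G : Butterfly E' E'')

/-- The homomorphism `⟨ι, κ'⟩ : E'₂ → F ×_{E'₁} F'`. -/
def glue : E'.E₂ →* pullback F.γ G.δ := pair F.γ G.δ F.ι G.κ fun x => by rw [F.γ_ι, G.δ_κ]

instance glue_normal : (glue F G).range.Normal := by
  constructor
  rintro _ ⟨x, rfl⟩ ⟨⟨f, g⟩, h⟩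
  have h' : F.γ f = G.δ g := h
  refine ⟨E'.act (F.γ f) x, Subtype.ext (Prod.ext (F.ι_act f x) ?_)⟩
  change G.κ (E'.act (F.γ f) x) = g * G.κ x * g⁻¹
  rw [h', G.κ_act]

/-- The cokernel of `⟨ι, κ'⟩`, the central group of the composite butterfly. -/
abbrev CompCarrier : Type u := pullback F.γ G.δ ⧸ (glue F G).range

/-- The quotient homomorphism onto the central group of the composite butterfly. -/
def compMk : pullback F.γ G.δ →* CompCarrier F G := QuotientGroup.mk' _

theorem compMk_surjective : Function.Surjective (compMk F G) := QuotientGroup.mk'_surjective _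

variable {F G} in
theorem compMk_eq_one {x : pullback F.γ G.δ} :
    compMk F G x = 1 ↔ ∃ y, F.ι y = x.1.1 ∧ G.κ y = x.1.2 := by
  rw [compMk, QuotientGroup.mk'_apply, QuotientGroup.eq_one_iff]
  constructor
  · rintro ⟨b, rfl⟩
    exact ⟨b, rfl, rfl⟩
  · rintro ⟨b, h, h'⟩
    exact ⟨b, Subtype.ext (Prod.ext h h')⟩

variable {F G} in
theorem compMk_eq {x x' : pullback F.γ G.δ} :
    compMk F G x = compMk F G x' ↔ ∃ y, F.ι y = x.1.1⁻¹ * x'.1.1 ∧ G.κ y = x.1.2⁻¹ * x'.1.2 := by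
  rw [← inv_mul_eq_one, ← map_inv, ← map_mul]
  exact compMk_eq_one

/-- `⟨κ, 0⟩ : E₂ → F ×_{E'₁} F'`. -/
def compInl : E.E₂ →* pullback F.γ G.δ :=
  pair F.γ G.δ F.κ 1 fun x => (F.γ_κ x).trans (map_one G.δ).symm

/-- `⟨0, ι'⟩ : E''₂ → F ×_{E'₁} F'`. -/
def compInr : E''.E₂ →* pullback F.γ G.δ :=
  pair F.γ G.δ 1 G.ι fun x => (map_one F.γ).trans (G.δ_ι x).symm

/-- The composite of two butterflies. -/
def comp : Butterfly E E'' where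
  carrier := CompCarrier F G
  κ := (compMk F G).comp (compInl F G)
  ι := (compMk F G).comp (compInr F G)
  δ := QuotientGroup.lift _ (F.δ.comp (pr₁ _ _)) (by rintro _ ⟨x, rfl⟩; exact F.δ_ι x)
  γ := QuotientGroup.lift _ (G.γ.comp (pr₂ _ _)) (by rintro _ ⟨x, rfl⟩; exact G.γ_κ x)
  δ_κ x := F.δ_κ x
  γ_ι x := G.γ_ι x
  p_δ x := by
    obtain ⟨⟨⟨f, g⟩, h⟩, rfl⟩ := compMk_surjective F G x
    have h' : F.γ f = G.δ g := h
    change E.p (F.δ f) = E''.p (G.γ g)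
    rw [F.p_δ, ← G.p_δ, h']
  γ_κ x := map_one G.γ
  ι_injective := by
    rw [injective_iff_map_eq_one]
    intro x hx
    obtain ⟨y, hy1, hy2⟩ := compMk_eq_one.1 hx
    have hy : y = 1 := F.ι_injective (hy1.trans (map_one F.ι).symm)
    subst hy
    exact G.ι_injective (hy2.symm.trans ((map_one G.κ).trans (map_one G.ι).symm))
  δ_eq_one_iff x := by
    obtain ⟨⟨⟨f, g⟩, h⟩, rfl⟩ := compMk_surjective F G x
    have h' : F.γ f = G.δ g := h
    constructor
    · intro hx
      obtain ⟨y, rfl⟩ := (F.δ_eq_one_iff f).1 hx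
      obtain ⟨z, hz⟩ := (G.δ_eq_one_iff ((G.κ y)⁻¹ * g)).1 (by
        rw [map_mul, map_inv, G.δ_κ, ← h', F.γ_ι, inv_mul_cancel])
      refine ⟨z, compMk_eq.2 ⟨y, ?_, ?_⟩⟩
      · change _ = (1 : F.carrier)⁻¹ * F.ι y
        simp
      · change G.κ y = (G.ι z)⁻¹ * g
        have hd : G.γ (G.κ y) = 1 := G.γ_κ y
        have hc := G.ι_act (G.κ y) z
        rw [hd, map_one, eq_mul_inv_iff_mul_eq] at hc
        have hc' : G.ι z * G.κ y = G.κ y * G.ι z := hc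
        rw [eq_inv_mul_iff_mul_eq, hc', hz, mul_inv_cancel_left]
    · rintro ⟨z, hz⟩
      obtain ⟨y, hy1, -⟩ := compMk_eq.1 hz
      have hy : F.ι y = 1⁻¹ * f := hy1
      change F.δ f = 1
      rw [inv_one, one_mul] at hy
      rw [← hy, F.δ_ι]
  δ_surjective e := by
    obtain ⟨f, rfl⟩ := F.δ_surjective e
    obtain ⟨g, hg⟩ := G.δ_surjective (F.γ f)
    exact ⟨compMk F G ⟨(f, g), hg.symm⟩, rfl⟩
  κ_act x y := by
    obtain ⟨⟨⟨f, g⟩, h⟩, rfl⟩ := compMk_surjective F G x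
    change compMk F G _ = compMk F G _ * compMk F G _ * (compMk F G _)⁻¹
    rw [← map_inv, ← map_mul, ← map_mul]
    refine congrArg _ (Subtype.ext (Prod.ext (F.κ_act f y) ?_))
    change 1 = g * 1 * g⁻¹
    simp
  ι_act x y := by
    obtain ⟨⟨⟨f, g⟩, h⟩, rfl⟩ := compMk_surjective F G x
    change compMk F G _ = compMk F G _ * compMk F G _ * (compMk F G _)⁻¹
    rw [← map_inv, ← map_mul, ← map_mul]
    refine congrArg _ (Subtype.ext (Prod.ext ?_ (G.ι_act g y)))
    change 1 = f * 1 * f⁻¹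
    simp

variable {F G} in
/-- Constructing an isomorphism from a composite butterfly. -/
theorem nonempty_iso_of {H : Butterfly E E''} (φ : pullback F.γ G.δ →* H.carrier)
    (h : ∀ y, φ (glue F G y) = 1) (hι : ∀ x, φ (compInr F G x) = H.ι x)
    (hκ : ∀ x, φ (compInl F G x) = H.κ x) (hγ : ∀ x, H.γ (φ x) = G.γ x.1.2)
    (hδ : ∀ x, H.δ (φ x) = F.δ x.1.1) : Nonempty (Iso (comp F G) H) := by
  obtain ⟨f, hf⟩ := exists_descend (compMk F G) (compMk_surjective F G) φ (by
    intro x hx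
    obtain ⟨y, hy1, hy2⟩ := compMk_eq_one.1 hx
    rw [← h y]
    exact congrArg φ (Subtype.ext (Prod.ext hy1.symm hy2.symm)))
  refine ⟨Iso.ofHom (F := comp F G) f (fun x => (hf _).trans (hι x))
    (fun x => (hf _).trans (hκ x)) (fun x => ?_) fun x => ?_⟩
  · obtain ⟨x, rfl⟩ := compMk_surjective F G x
    exact (congrArg H.γ (hf x)).trans (hγ x)
  · obtain ⟨x, rfl⟩ := compMk_surjective F G x
    exact (congrArg H.δ (hf x)).trans (hδ x)

end comp

theorem comp_congr {F F' : Butterfly E E'} {G G' : Butterfly E' E''} (f : Iso F F')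
    (g : Iso G G') : Nonempty (Iso (comp F G) (comp F' G')) := by
  let ψ : pullback F.γ G.δ →* pullback F'.γ G'.δ :=
    pair F'.γ G'.δ (f.equiv.toMonoidHom.comp (pr₁ _ _)) (g.equiv.toMonoidHom.comp (pr₂ _ _))
      fun x => (f.γ_equiv _).trans (Eq.trans x.2 (g.δ_equiv _).symm)
  refine nonempty_iso_of (H := comp F' G') ((compMk F' G').comp ψ) (fun y => ?_) (fun x => ?_)
    (fun x => ?_) (fun x => g.γ_equiv _) (fun x => f.δ_equiv _)
  · exact compMk_eq_one.2 ⟨y, (f.equiv_ι y).symm, (g.equiv_κ y).symm⟩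
  · exact congrArg (compMk F' G') (Subtype.ext (Prod.ext (map_one f.equiv) (g.equiv_ι x)))
  · exact congrArg (compMk F' G') (Subtype.ext (Prod.ext (f.equiv_κ x) (map_one g.equiv)))

theorem comp_id (F : Butterfly E E') : Nonempty (Iso (comp F (id E')) F) := by
  let φ : pullback F.γ (id E').δ →* F.carrier :=
    MonoidHom.mk' (fun x => F.ι x.1.2.left * x.1.1) (by
      rintro ⟨⟨f, ⟨y, g⟩⟩, h⟩ ⟨⟨f', ⟨y', g'⟩⟩, h'⟩
      have hc : F.γ f = g := h
      subst hc
      change F.ι (y * E'.act (F.γ f) y') * (f * f') = F.ι y * f * (F.ι y' * f')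
      rw [map_mul, F.ι_act]
      group)
  refine nonempty_iso_of φ (fun y => ?_) (fun x => ?_) (fun x => ?_) (fun x => ?_) (fun x => ?_)
  · change F.ι y⁻¹ * F.ι y = 1
    simp
  · change F.ι x * 1 = _
    simp
  · change F.ι 1 * F.κ x = _
    simp
  · obtain ⟨⟨f, ⟨y, g⟩⟩, h⟩ := x
    have hc : F.γ f = g := h
    change F.γ (F.ι y * f) = E'.bd y * g
    rw [map_mul, F.γ_ι, hc]
  · change F.δ (F.ι _ * _) = _
    rw [map_mul, F.δ_ι, one_mul]

theorem id_comp (F : Butterfly E E') : Nonempty (Iso (comp (id E) F) F) := by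
  let φ : pullback (id E).γ F.δ →* F.carrier :=
    MonoidHom.mk' (fun x => (F.κ x.1.1.left)⁻¹ * x.1.2) (by
      rintro ⟨⟨⟨y, g⟩, f⟩, h⟩ ⟨⟨⟨y', g'⟩, f'⟩, h'⟩
      have hc : E.bd y * g = F.δ f := h
      change (F.κ (y * E.act g y'))⁻¹ * (f * f') = (F.κ y)⁻¹ * f * ((F.κ y')⁻¹ * f')
      have h1 : F.κ (E.act (F.δ f) y') = f * F.κ y' * f⁻¹ := F.κ_act f y'
      rw [← hc, map_mul] at h1
      have h2 : F.κ (E.act (E.bd y) (E.act g y')) = f * F.κ y' * f⁻¹ := h1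
      rw [E.peiffer, map_mul, map_mul, map_inv] at h2
      have h3 : F.κ (E.act g y') = (F.κ y)⁻¹ * (f * F.κ y' * f⁻¹) * F.κ y := by
        rw [← h2]; group
      rw [map_mul, h3]
      group)
  refine nonempty_iso_of φ (fun y => ?_) (fun x => ?_) (fun x => ?_) (fun x => ?_) (fun x => ?_)
  · change (F.κ y)⁻¹ * F.κ y = 1
    simp
  · change (F.κ 1)⁻¹ * F.ι x = _
    simp
  · change (F.κ x⁻¹)⁻¹ * 1 = F.κ x
    simp
  · change F.γ ((F.κ _)⁻¹ * _) = _
    rw [map_mul, map_inv, F.γ_κ, inv_one, one_mul]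
  · obtain ⟨⟨⟨y, g⟩, f⟩, h⟩ := x
    have hc : E.bd y * g = F.δ f := h
    change F.δ ((F.κ y)⁻¹ * f) = g
    rw [map_mul, map_inv, F.δ_κ, ← hc, inv_mul_cancel_left]

theorem comp_assoc (F : Butterfly E E') (G : Butterfly E' E'') (H : Butterfly E'' E''') :
    Nonempty (Iso (comp (comp F G) H) (comp F (comp G H))) := by
  let T := pullback (G.γ.comp (pr₂ F.γ G.δ)) H.δ
  let π : T →* pullback (comp F G).γ H.δ :=
    pair (comp F G).γ H.δ ((compMk F G).comp (pr₁ _ _)) (pr₂ _ _) fun x => x.2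
  have hπ : Function.Surjective π := by
    rintro ⟨⟨x, h⟩, hx⟩
    obtain ⟨x, rfl⟩ := compMk_surjective F G x
    exact ⟨⟨(x, h), hx⟩, rfl⟩
  let ρ₀ : T →* pullback G.γ H.δ :=
    pair G.γ H.δ ((pr₂ _ _).comp (pr₁ _ _)) (pr₂ _ _) fun x => x.2
  let ρ : T →* pullback F.γ (comp G H).δ :=
    pair F.γ (comp G H).δ ((pr₁ _ _).comp (pr₁ _ _)) ((compMk G H).comp ρ₀)
      fun x => x.1.1.2
  have hs : Function.Surjective ((compMk (comp F G) H).comp π) :=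
    (compMk_surjective _ _).comp hπ
  obtain ⟨φ, hφ⟩ := exists_descend ((compMk (comp F G) H).comp π) hs
    ((compMk F (comp G H)).comp ρ) (by
      rintro ⟨⟨⟨⟨f, g⟩, h₁⟩, h⟩, h₂⟩ ht
      obtain ⟨y, hy, hy'⟩ := compMk_eq_one.1 ht
      have hy1 : compMk F G (compInr F G y) = compMk F G ⟨(f, g), h₁⟩ := hy
      obtain ⟨a, ha1, ha2⟩ := compMk_eq.1 hy1
      have ha1' : F.ι a = 1⁻¹ * f := ha1
      have ha2' : G.κ a = (G.ι y)⁻¹ * g := ha2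
      have hy2 : H.κ y = h := hy'
      refine compMk_eq_one.2 ⟨a, by rw [ha1', inv_one, one_mul]; rfl, ?_⟩
      change compMk G H (compInl G H a) = compMk G H (ρ₀ _)
      refine compMk_eq.2 ⟨y, ?_, ?_⟩
      · change G.ι y = (G.κ a)⁻¹ * g
        have hc := G.ι_act (G.κ a) y
        rw [G.γ_κ, map_one, eq_mul_inv_iff_mul_eq] at hc
        have hc' : G.ι y * G.κ a = G.κ a * G.ι y := hc
        rw [eq_inv_mul_iff_mul_eq, ← hc', ha2', mul_inv_cancel_left]
      · change H.κ y = 1⁻¹ * h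
        rw [hy2, inv_one, one_mul])
  refine ⟨Iso.ofHom (F := comp (comp F G) H) (G := comp F (comp G H)) φ
    (fun x => ?_) (fun x => ?_) (fun x => ?_) (fun x => ?_)⟩
  · exact hφ ⟨(1, H.ι x), (map_one (G.γ.comp (pr₂ F.γ G.δ))).trans (H.δ_ι x).symm⟩
  · refine (hφ ⟨(compInl F G x, 1), (map_one G.γ).trans (map_one H.δ).symm⟩).trans ?_
    refine congrArg (compMk F (comp G H)) (Subtype.ext (Prod.ext rfl ?_))
    exact map_one (compMk G H)
  · obtain ⟨t, rfl⟩ := hs x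
    exact congrArg (comp F (comp G H)).γ (hφ t)
  · obtain ⟨t, rfl⟩ := hs x
    exact congrArg (comp F (comp G H)).δ (hφ t)

/-! #### The module morphism of a butterfly -/

theorem exists_beta (F : Butterfly E E') (b : Multiplicative E.mod) :
    ∃ b' : Multiplicative E'.mod, F.κ (E.j b) * F.ι (E'.j b') = 1 := by
  obtain ⟨x, hx⟩ := (F.δ_eq_one_iff (F.κ (E.j b))⁻¹).1 (by
    rw [map_inv, F.δ_κ, E.bd_j, inv_one])
  obtain ⟨b', rfl⟩ := (E'.bd_eq_one_iff x).1 (by rw [← F.γ_ι, hx, map_inv, F.γ_κ, inv_one])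
  exact ⟨b', by rw [hx, mul_inv_cancel]⟩

/-- The underlying function of the module morphism `β`. -/
def betaFun (F : Butterfly E E') (b : Multiplicative E.mod) : Multiplicative E'.mod :=
  (F.exists_beta b).choose

theorem betaFun_spec (F : Butterfly E E') (b : Multiplicative E.mod) :
    F.κ (E.j b) * F.ι (E'.j (F.betaFun b)) = 1 := (F.exists_beta b).choose_spec

theorem betaFun_eq (F : Butterfly E E') (b : Multiplicative E.mod) (b' : Multiplicative E'.mod)
    (h : F.κ (E.j b) * F.ι (E'.j b') = 1) : F.betaFun b = b' :=
  E'.j_injective (F.ι_injective (mul_left_cancel ((F.betaFun_spec b).trans h.symm)))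

theorem κ_ι_comm (F : Butterfly E E') (x y) : F.ι y * F.κ x = F.κ x * F.ι y := by
  have hc := F.ι_act (F.κ x) y
  rw [F.γ_κ, map_one, eq_mul_inv_iff_mul_eq] at hc
  exact hc

theorem betaFun_mul (F : Butterfly E E') (b b') :
    F.betaFun (b * b') = F.betaFun b * F.betaFun b' := by
  apply betaFun_eq
  rw [map_mul, map_mul, map_mul, map_mul, mul_assoc, ← mul_assoc (F.κ (E.j b')), ← κ_ι_comm,
    mul_assoc, betaFun_spec, mul_one, betaFun_spec]

theorem betaFun_act (F : Butterfly E E') (c : C) (b) :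
    F.betaFun (modAct E.mod c b) = modAct E'.mod c (F.betaFun b) := by
  obtain ⟨e, rfl⟩ := E.p_surjective c
  obtain ⟨f, rfl⟩ := F.δ_surjective e
  apply betaFun_eq
  rw [← E.act_j, F.p_δ, ← E'.act_j, F.κ_act, F.ι_act]
  have := F.betaFun_spec b
  rw [mul_eq_one_iff_eq_inv] at this
  rw [this]
  group

/-- The additive map underlying `β`. -/
def betaAdd (F : Butterfly E E') : E.mod →+ E'.mod :=
  AddMonoidHom.mk' (fun b => (F.betaFun (Multiplicative.ofAdd b)).toAdd)
    fun _ _ => congrArg Multiplicative.toAdd (F.betaFun_mul _ _)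

/-- The morphism of `C`-modules induced by a butterfly: it is characterised by
`κ (j b) = - ι (j' (β b))`. -/
def beta (F : Butterfly E E') : E.mod ⟶ E'.mod :=
  repHom F.betaAdd
    (fun n b => @map_intCast_smul _ _ _ _ _ _ _ F.betaAdd ℤ ℤ _ _ E.mod.hV2 E'.mod.hV2 n b)
    fun c b => congrArg Multiplicative.toAdd (F.betaFun_act c (Multiplicative.ofAdd b))

theorem beta_spec (F : Butterfly E E') (b : E.mod) :
    F.κ (E.j (Multiplicative.ofAdd b)) * F.ι (E'.j (Multiplicative.ofAdd (F.beta b))) = 1 :=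
  F.betaFun_spec (Multiplicative.ofAdd b)

theorem beta_eq (F : Butterfly E E') (f : E.mod ⟶ E'.mod)
    (h : ∀ b : E.mod, F.κ (E.j (Multiplicative.ofAdd b)) *
      F.ι (E'.j (Multiplicative.ofAdd (f b))) = 1) : F.beta = f := by
  refine rep_ext fun b => ?_
  exact congrArg Multiplicative.toAdd (F.betaFun_eq (Multiplicative.ofAdd b) _ (h b))

theorem beta_congr {F G : Butterfly E E'} (f : Iso F G) : F.beta = G.beta := by
  apply beta_eq
  intro b
  rw [← f.symm.equiv_κ, ← f.symm.equiv_ι, ← map_mul, G.beta_spec, map_one]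

theorem beta_id (E : CrossedExtension C) : (Butterfly.id E).beta = 𝟙 E.mod := by
  apply beta_eq
  intro b
  refine SemidirectProduct.ext ?_ ?_
  · change (E.j (Multiplicative.ofAdd b))⁻¹ *
      E.act (E.bd (E.j _)) (E.j (Multiplicative.ofAdd b)) = 1
    rw [E.bd_j, map_one]
    exact inv_mul_cancel _
  · change E.bd (E.j _) * 1 = 1
    rw [E.bd_j, mul_one]

theorem beta_comp (F : Butterfly E E') (G : Butterfly E' E'') :
    (comp F G).beta = F.beta ≫ G.beta := by
  apply beta_eq
  intro b
  change compMk F G (compInl F G _) * compMk F G (compInr F G _) = 1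
  rw [← map_mul]
  refine compMk_eq_one.2 ⟨(E'.j (Multiplicative.ofAdd (F.beta b)))⁻¹, ?_, ?_⟩
  · change _ = F.κ _ * 1
    rw [map_inv, mul_one, inv_eq_iff_mul_eq_one, κ_ι_comm]
    exact F.beta_spec b
  · change _ = 1 * G.ι (E''.j (Multiplicative.ofAdd (G.beta (F.beta b))))
    rw [map_inv, one_mul, inv_eq_iff_mul_eq_one]
    exact G.beta_spec _

end Butterfly

open Butterfly

/-! ### The third cohomology 2-group -/

/-- The objects of `[BExt](C)`: crossed extensions of `C`. -/
structure BExt (C : Type u) [Group C] where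
  /-- the underlying crossed extension -/
  ext : CrossedExtension C

/-- The category `[BExt](C)`: arrows are isomorphism classes of butterflies. -/
instance : Category (BExt C) where
  Hom X Y := Quotient (Butterfly.setoid X.ext Y.ext)
  id X := Quotient.mk _ (Butterfly.id X.ext)
  comp := Quotient.map₂ Butterfly.comp fun _ _ h _ _ h' => by
    obtain ⟨f⟩ : Nonempty (Butterfly.Iso _ _) := h
    obtain ⟨g⟩ : Nonempty (Butterfly.Iso _ _) := h'
    exact comp_congr f g
  id_comp := by
    rintro X Y ⟨F⟩
    exact Quotient.sound (s := Butterfly.setoid X.ext Y.ext) (Butterfly.id_comp F)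
  comp_id := by
    rintro X Y ⟨F⟩
    exact Quotient.sound (s := Butterfly.setoid X.ext Y.ext) (Butterfly.comp_id F)
  assoc := by
    rintro X _ _ Y ⟨F⟩ ⟨G⟩ ⟨H⟩
    exact Quotient.sound (s := Butterfly.setoid X.ext Y.ext) (Butterfly.comp_assoc F G H)

/-- The arrow of `[BExt](C)` represented by a butterfly. -/
def Butterfly.toHom {E E' : CrossedExtension C} (F : Butterfly E E') : BExt.mk E ⟶ BExt.mk E' :=
  Quotient.mk _ F

/-- The functor from `[BExt](C)` to `C`-modules that sends a crossed extension to its kernel and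
the class of a butterfly to the induced morphism `β`. -/
def PBar (C : Type u) [Group C] : BExt C ⥤ Rep.{u} ℤ C where
  obj X := X.ext.mod
  map := Quotient.lift Butterfly.beta fun _ _ h => by
    obtain ⟨f⟩ : Nonempty (Butterfly.Iso _ _) := h
    exact beta_congr f
  map_id X := beta_id X.ext
  map_comp := by
    rintro _ _ _ ⟨F⟩ ⟨G⟩
    exact beta_comp F G

/-- The underlying category of the third cohomology 2-group of `C` with coefficients in `M`: the
fibre of `PBar C` over `M`. -/
abbrev H3 (M : Rep.{u} ℤ C) : Type (u + 1) := (PBar C).Fiber M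

/-- The unit object of the third cohomology 2-group. -/
def H3.unit (M : Rep.{u} ℤ C) : H3 M := 
  Functor.Fiber.mk (p := PBar C) (a := BExt.mk (CrossedExtension.unit M)) rfl

/-- The group `π₁` of the third cohomology 2-group: automorphisms of the unit object. -/
abbrev Pi₁ (M : Rep.{u} ℤ C) : Type (u + 1) := Aut (H3.unit M)

/-- The arrow of `[BExt](C)` underlying an automorphism of the unit object. -/
def Pi₁.arrow {M : Rep.{u} ℤ C} (a : Pi₁ M) :
    BExt.mk (CrossedExtension.unit M) ⟶ BExt.mk (CrossedExtension.unit M) :=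
  Functor.Fiber.fiberInclusion.map a.hom

/-! ### The functor `Φ` -/

/-- The groupoid `Eq(I)`: butterflies from the unit crossed extension to itself that induce the
identity on `M`, and their isomorphisms. -/
abbrev EqI (M : Rep.{u} ℤ C) : Type (u + 1) :=
  ObjectProperty.FullSubcategory fun F : Butterfly (unit M) (unit M) => F.beta = 𝟙 M

/-- The butterfly with central group `E` and legs `-κ`, `κ`, `γ`, `γ`. -/
def phiObj {M : Rep.{u} ℤ C} (E : OpExt M) : Butterfly (unit M) (unit M) where
  carrier := E.carrier
  κ := E.κ.comp (MonoidHom.id _)⁻¹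
  ι := E.κ
  δ := E.γ
  γ := E.γ
  δ_κ x := E.γ_κ _
  γ_ι x := E.γ_κ _
  p_δ f := rfl
  γ_κ x := E.γ_κ _
  ι_injective := E.ext.inl_injective
  δ_eq_one_iff f := ⟨E.exact f, by rintro ⟨b, rfl⟩; exact E.γ_κ b⟩
  δ_surjective := E.ext.rightHom_surjective
  κ_act f (x : Multiplicative M) := by
    change E.κ (modAct M (E.γ f) x)⁻¹ = f * E.κ x⁻¹ * f⁻¹
    rw [← map_inv (modAct M (E.γ f))]
    exact (E.conj f (-x.toAdd)).symm
  ι_act f x := (E.conj f x.toAdd).symm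

/-- The functor `Φ : OpExt(C, M) ⥤ Eq(I)`. -/
def Phi (M : Rep.{u} ℤ C) : OpExt M ⥤ EqI M where
  obj E := ⟨phiObj E, by
    apply beta_eq
    intro b
    change E.κ (Multiplicative.ofAdd b)⁻¹ * E.κ (Multiplicative.ofAdd b) = 1
    simp⟩
  map f := ObjectProperty.homMk (Iso.ofHom (F := phiObj _) (G := phiObj _) f.hom
    f.hom_κ (fun x => f.hom_κ x⁻¹) f.γ_hom f.γ_hom)
  map_id _ := ObjectProperty.hom_ext _ (Iso.ext (MulEquiv.ext fun _ => rfl))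
  map_comp _ _ := ObjectProperty.hom_ext _ (Iso.ext (MulEquiv.ext fun _ => rfl))

/-! ### Group cohomology -/

/-- A representation over `k`, regarded as a representation over the copy of `k` in a higher
universe (Mathlib's group cohomology needs `k` and the group in the same universe). -/
def liftRep {k : Type} [CommRing k] (M : Rep.{u} k C) : Rep.{u} (ULift.{u} k) C :=
  Rep.of (X := M.V) (k := ULift.{u} k) (G := C)
    { toFun := fun c =>
        { toFun := M.ρ c
          map_add' := map_add _
          map_smul' := fun n b => map_smul (M.ρ c) n.down b }
      map_one' := LinearMap.ext fun b => by simp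
      map_mul' := fun c d => LinearMap.ext fun b => by simp }

/-- The usual second cohomology group of `C` with coefficients in `M`. -/
abbrev H2 (M : Rep.{u} ℤ C) : Type u := groupCohomology (liftRep M) 2

end CohTwoGroup
end

/-! Two computations meet in the group of isomorphism classes of extensions.

Butterflies. In the unit crossed extension `p` is the identity and the boundary is trivial. For a
butterfly from it to itself, the condition `p δ = p' γ` therefore says `δ = γ`, and `β = 1` says `κ
= -ι`. Such a butterfly is thus exactly an extension `(ι, δ)` of `C` by `M`, the action being
recovered from `ι_act`, and an isomorphism of butterflies is the same thing as a morphism of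
extensions (`nonempty_iso_phiObj`, `hom_of_iso_phiObj`). The composite of two of them is the
quotient of `E ×_C E'` by the elements `(κ b, -κ' b)`, which is the Baer sum (`comp_phiObj`). Hence
`Φ` induces a bijection on components and carries the Baer sum to composition. The group `π₁` is
abelian because the Baer sum is commutative.

Cohomology. A set-theoretic section `s` of an extension writes each element uniquely as `κ b * s c`,
so the extension is determined by its factor set `f`, where `s c * s d = κ (f (c, d)) * s (c * d)`.
Associativity is the cocycle identity, a change of section adds a coboundary, and factor sets add
under the Baer sum. Conversely, each cocycle twists the product on `M × C` into an extension.
Schreier's correspondence then gives `π₀ ≅ H²`. Sections are not required to send `1` to `1`, so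
cocycles are not normalised and the value `f (1, 1)` appears throughout as a correction. -/

noncomputable section

namespace CohTwoGroup

/-! ### Factor sets of extensions -/

namespace OpExt

variable {C : Type u} [Group C] {M : Rep.{u} ℤ C}

/-- A 2-cocycle of `C` with values in `M`, as a bare function. -/
def IsCocycle (f : C × C → M) : Prop :=
  ∀ c d e, f (c * d, e) + f (c, d) = M.ρ c (f (d, e)) + f (c, d * e)

/-- `s` is a set-theoretic section of `E → C` with factor set `f`. -/
structure IsFactorSet (E : OpExt M) (s : C → E.carrier) (f : C × C → M) : Prop where
  γ_section : ∀ c, E.γ (s c) = c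
  mul_section : ∀ c d, s c * s d = E.κ (Multiplicative.ofAdd (f (c, d))) * s (c * d)

theorem ρ_one (b : M) : M.ρ 1 b = b := by rw [map_one]; rfl

theorem ρ_mul (c d : C) (b : M) : M.ρ (c * d) b = M.ρ c (M.ρ d b) := by rw [map_mul]; rfl

theorem exists_isFactorSet_of_section (E : OpExt M) (s : C → E.carrier)
    (hs : ∀ c, E.γ (s c) = c) : ∃ f, E.IsFactorSet s f := by
  have h (x : C × C) : ∃ b, E.κ b = s x.1 * s x.2 * (s (x.1 * x.2))⁻¹ :=
    E.exists_diff _ _ (by rw [map_mul, hs, hs, hs])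
  choose b hb using h
  refine ⟨fun x => (b x).toAdd, hs, fun c d => ?_⟩
  rw [ofAdd_toAdd, hb, inv_mul_cancel_right]

theorem exists_isFactorSet (E : OpExt M) : ∃ s f, E.IsFactorSet s f :=
  ⟨_, E.exists_isFactorSet_of_section _ (Function.surjInv_eq E.ext.rightHom_surjective)⟩

theorem κ_add (E : OpExt M) (a b : M) : E.κ (Multiplicative.ofAdd (a + b)) =
    E.κ (Multiplicative.ofAdd a) * E.κ (Multiplicative.ofAdd b) := by
  rw [ofAdd_add, map_mul]

theorem κ_cancel (E : OpExt M) {a b : M} {e : E.carrier}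
    (h : E.κ (Multiplicative.ofAdd a) * e = E.κ (Multiplicative.ofAdd b) * e) : a = b :=
  Multiplicative.ofAdd.injective (E.ext.inl_injective (mul_right_cancel h))

/-! ### Calculus with factor sets -/

namespace IsFactorSet

variable {E E' : OpExt M} {s : C → E.carrier} {s' : C → E'.carrier} {f f' : C × C → M}

theorem section_mul_κ (h : E.IsFactorSet s f) (c : C) (b : M) :
    s c * E.κ (Multiplicative.ofAdd b) = E.κ (Multiplicative.ofAdd (M.ρ c b)) * s c := by
  rw [E.conj', h.γ_section]

/-- Both bracketings of `s c * s d * s e` are pushed into the form `κ _ * s (c * d * e)`. The action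
of `c` enters when `s c` moves past `κ (f (d, e))`. -/
theorem cocycle (h : E.IsFactorSet s f) : IsCocycle f := by
  intro c d e
  apply E.κ_cancel (e := s (c * d * e))
  rw [add_comm, κ_add, κ_add, mul_assoc, ← h.mul_section, ← mul_assoc, ← h.mul_section,
    mul_assoc c, mul_assoc, h.mul_section d e, ← mul_assoc, h.section_mul_κ, mul_assoc, mul_assoc,
    ← h.mul_section c]

theorem map (h : E.IsFactorSet s f) (φ : E ⟶ E') : E'.IsFactorSet (fun c => φ.hom (s c)) f where
  γ_section c := (φ.γ_hom _).trans (h.γ_section c)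
  mul_section c d := by rw [← map_mul, h.mul_section, map_mul, φ.hom_κ]

/-- Multiplying the section by values of `κ` changes the factor set by the coboundary of `x`: in the
product, `κ (x d)` has to cross `s c`, which turns it into `κ (c • x d)`. -/
theorem add_coboundary (h : E.IsFactorSet s f) (x : C → M) :
    E.IsFactorSet (fun c => E.κ (Multiplicative.ofAdd (x c)) * s c)
      (fun p => f p + (M.ρ p.1 (x p.2) - x (p.1 * p.2) + x p.1)) where
  γ_section c := by rw [map_mul, E.γ_κ, one_mul, h.γ_section]
  mul_section c d := by
    rw [← mul_assoc (E.κ _) (E.κ _), ← κ_add, mul_assoc, ← mul_assoc (s c), h.section_mul_κ,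
      mul_assoc, h.mul_section, ← mul_assoc, ← mul_assoc, ← κ_add, ← κ_add]
    congr 3
    abel

theorem unique (h : E.IsFactorSet s f) (h' : E.IsFactorSet s f') : f = f' :=
  funext fun _ => E.κ_cancel ((h.mul_section _ _).symm.trans (h'.mul_section _ _))

/-- Two sections differ pointwise by an element of the kernel, so this is the converse of
`add_coboundary`, combined with the fact that a section determines its factor set. It makes the
cohomology class independent of the section. -/
theorem exists_coboundary {t : C → E.carrier} (h : E.IsFactorSet s f) (h' : E.IsFactorSet t f') :
    ∃ x : C → M, ∀ c d, f' (c, d) = f (c, d) + (M.ρ c (x d) - x (c * d) + x c) := by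
  have hd (c : C) : ∃ b, E.κ b = t c * (s c)⁻¹ :=
    E.exists_diff _ _ (by rw [h.γ_section, h'.γ_section])
  choose x hx using hd
  refine ⟨fun c => (x c).toAdd, fun c d => ?_⟩
  have ht : t = fun c => E.κ (Multiplicative.ofAdd (x c).toAdd) * s c := by
    funext c
    rw [ofAdd_toAdd, hx, inv_mul_cancel_right]
  subst ht
  exact congrFun (h'.unique (h.add_coboundary _)) (c, d)

theorem exists_eq_κ_mul (h : E.IsFactorSet s f) (e : E.carrier) :
    ∃ b c, e = E.κ (Multiplicative.ofAdd b) * s c := by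
  obtain ⟨b, hb⟩ := E.exists_diff e (s (E.γ e)) (h.γ_section _).symm
  exact ⟨b.toAdd, E.γ e, by rw [ofAdd_toAdd, hb, inv_mul_cancel_right]⟩

theorem κ_mul_injective (h : E.IsFactorSet s f) {b b' : M} {c c' : C}
    (he : E.κ (Multiplicative.ofAdd b) * s c = E.κ (Multiplicative.ofAdd b') * s c') :
    b = b' ∧ c = c' := by
  have hc := congrArg E.γ he
  rw [map_mul, map_mul, E.γ_κ, E.γ_κ, h.γ_section, h.γ_section, one_mul, one_mul] at hc
  subst hc
  exact ⟨E.κ_cancel he, rfl⟩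

/-- The multiplication of `E` in the coordinates `(b, c)`: it depends only on the action and on `f`.
The same formula defines the product on `Twisted`. -/
theorem κ_mul_mul (h : E.IsFactorSet s f) (b b' : M) (c c' : C) :
    E.κ (Multiplicative.ofAdd b) * s c * (E.κ (Multiplicative.ofAdd b') * s c') =
      E.κ (Multiplicative.ofAdd (b + M.ρ c b' + f (c, c'))) * s (c * c') := by
  rw [κ_add, κ_add, mul_assoc, ← mul_assoc (s c), h.section_mul_κ, mul_assoc, h.mul_section,
    ← mul_assoc, ← mul_assoc]

/-- A section at `1` is determined by the factor set. -/
theorem section_one (h : E.IsFactorSet s f) : s 1 = E.κ (Multiplicative.ofAdd (f (1, 1))) := by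
  have := h.mul_section 1 1
  rw [mul_one] at this
  exact mul_right_cancel this

/-- Extensions with a common factor set are isomorphic. -/
theorem nonempty_hom (h : E.IsFactorSet s f) (h' : E'.IsFactorSet s' f) : Nonempty (E ⟶ E') := by
  choose b c hbc using h.exists_eq_κ_mul
  let ψ : E.carrier → E'.carrier := fun e => E'.κ (Multiplicative.ofAdd (b e)) * s' (c e)
  -- Uniqueness of the normal form frees `ψ` from the chosen coordinates. Multiplicativity then
  -- reduces to applying `κ_mul_mul` on both sides.
  have hψ (a : M) (d : C) : ψ (E.κ (Multiplicative.ofAdd a) * s d) =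
      E'.κ (Multiplicative.ofAdd a) * s' d := by
    obtain ⟨h₁, h₂⟩ := h.κ_mul_injective (hbc (E.κ (Multiplicative.ofAdd a) * s d))
    change E'.κ (Multiplicative.ofAdd (b _)) * s' (c _) = _
    rw [← h₁, ← h₂]
  refine ⟨⟨MonoidHom.mk' ψ fun e e' => ?_, fun a => ?_, fun e => ?_⟩⟩
  · obtain ⟨a, d, rfl⟩ := h.exists_eq_κ_mul e
    obtain ⟨a', d', rfl⟩ := h.exists_eq_κ_mul e'
    rw [h.κ_mul_mul, hψ, hψ, hψ, h'.κ_mul_mul]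
  -- Since `s 1 = κ (f (1, 1))` need not be `1`, the normal form of `κ a` has first coordinate `a -
  -- f (1, 1)`.
  · have h₁ : E.κ a = E.κ (Multiplicative.ofAdd (a.toAdd - f (1, 1))) * s 1 := by
      rw [h.section_one, ← κ_add, sub_add_cancel, ofAdd_toAdd]
    change ψ (E.κ a) = _
    rw [h₁, hψ, h'.section_one, ← κ_add, sub_add_cancel, ofAdd_toAdd]
  · obtain ⟨a, d, rfl⟩ := h.exists_eq_κ_mul e
    change E'.γ (ψ _) = _
    rw [hψ, map_mul, map_mul, E.γ_κ, E'.γ_κ, h.γ_section, h'.γ_section]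

/-- Factor sets add up in the Baer sum. -/
theorem baer (h : E.IsFactorSet s f) (h' : E'.IsFactorSet s' f') :
    (baer E E').IsFactorSet
      (fun c => baerMk E E' ⟨(s c, s' c), (h.γ_section c).trans (h'.γ_section c).symm⟩)
      (fun p => f p + f' p) where
  γ_section c := h.γ_section c
  mul_section c d := by
    change baerMk E E' _ * baerMk E E' _ = baerMk E E' (inr E E' _) * baerMk E E' _
    rw [← map_mul, ← map_mul, ← div_eq_one, ← map_div, baerMk_eq_one]
    -- The two representatives differ by `κ (f (c, d))` in `E` and by `κ' (f' (c, d) - (f (c, d) +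
    -- f' (c, d))) = κ' (-f (c, d))` in `E'`, an antidiagonal element.
    refine ⟨Multiplicative.ofAdd (f (c, d)), ?_, ?_⟩
    · change _ = s c * s d / (1 * s (c * d))
      rw [h.mul_section, one_mul, mul_div_cancel_right]
    · change _ = s' c * s' d / (E'.κ (Multiplicative.ofAdd (f (c, d) + f' (c, d))) * s' (c * d))
      rw [h'.mul_section, mul_div_mul_right_eq_div, ofAdd_add, mul_comm, ← map_div,
        div_mul_cancel_left]

end IsFactorSet

/-! ### The extension with a given factor set -/

namespace IsCocycle

variable {f : C × C → M}

/-- The cocycle identity at `(1, 1, c)`; `one_right` is the identity at `(c, 1, 1)`. Together they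
replace normalisation. -/
theorem one_left (hf : IsCocycle f) (c : C) : f (1, c) = f (1, 1) := by
  have := hf 1 1 c
  simp only [one_mul, ρ_one] at this
  exact (add_left_cancel this).symm

theorem one_right (hf : IsCocycle f) (c : C) : f (c, 1) = M.ρ c (f (1, 1)) := by
  have := hf c 1 1
  simp only [mul_one] at this
  exact add_right_cancel this

/-- The set `M × C`, carrying the group structure twisted by the cocycle `f`. -/
@[nolint unusedArguments]
def Twisted (_ : IsCocycle f) : Type u := M × C

/-- The pair `(b, c)` stands for `κ b * s c`, and the product is read off from `κ_mul_mul`. The unit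
is `(-f (1, 1), 1)` because `s 1 = κ (f (1, 1))`, and the inverse is the solution of the left
inverse equation. -/
instance (hf : IsCocycle f) : Group hf.Twisted :=
  letI : Mul hf.Twisted := ⟨fun x y => (x.1 + M.ρ x.2 y.1 + f (x.2, y.2), x.2 * y.2)⟩
  letI : One hf.Twisted := ⟨(-f (1, 1), 1)⟩
  letI : Inv hf.Twisted :=
    ⟨fun x => (-f (1, 1) - M.ρ x.2⁻¹ x.1 - f (x.2⁻¹, x.2), x.2⁻¹)⟩
  Group.ofLeftAxioms
    (by
      rintro ⟨a, c⟩ ⟨a', c'⟩ ⟨a'', c''⟩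
      refine Prod.ext ?_ (mul_assoc c c' c'')
      change a + M.ρ c a' + f (c, c') + M.ρ (c * c') a'' + f (c * c', c'') =
        a + M.ρ c (a' + M.ρ c' a'' + f (c', c'')) + f (c, c' * c'')
      -- Associativity differs from the cocycle identity for `(c, c', c'')` only by terms common to
      -- both sides, so the two differences are equal.
      have h := hf c c' c''
      rw [map_add, map_add, ρ_mul]
      rw [← sub_eq_zero] at h ⊢
      rw [← h]
      abel)
    (by
      rintro ⟨a, c⟩
      refine Prod.ext ?_ (one_mul c)
      change -f (1, 1) + M.ρ 1 a + f (1, c) = a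
      rw [hf.one_left c, ρ_one]
      abel)
    (by
      rintro ⟨a, c⟩
      refine Prod.ext ?_ (inv_mul_cancel c)
      change -f (1, 1) - M.ρ c⁻¹ a - f (c⁻¹, c) + M.ρ c⁻¹ a + f (c⁻¹, c) = -f (1, 1)
      abel)

/-- The extension of `C` by `M` with factor set `f`. -/
def opExt (hf : IsCocycle f) : OpExt M where
  carrier := hf.Twisted
  ext :=
    -- The shift by `f (1, 1)` is forced: it sends `0` to the unit `(-f (1, 1), 1)`.
    { inl := MonoidHom.mk' (fun b => (b.toAdd - f (1, 1), (1 : C))) (fun b b' => by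
        refine Prod.ext ?_ (one_mul 1).symm
        change b.toAdd + b'.toAdd - f (1, 1) =
          b.toAdd - f (1, 1) + M.ρ 1 (b'.toAdd - f (1, 1)) + f (1, 1)
        rw [ρ_one]
        abel)
      rightHom := MonoidHom.mk' Prod.snd fun _ _ => rfl
      inl_injective := fun b b' h => Multiplicative.toAdd.injective
        (sub_left_injective (congrArg Prod.fst h))
      range_inl_eq_ker_rightHom := by
        ext ⟨a, c⟩
        constructor
        · rintro ⟨b, hb⟩
          exact (congrArg Prod.snd hb).symm
        · intro (h : c = 1)
          subst h
          exact ⟨Multiplicative.ofAdd (a + f (1, 1)), Prod.ext (add_sub_cancel_right _ _) rfl⟩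
      rightHom_surjective := fun c => ⟨(0, c), rfl⟩ }
  conj := by
    rintro ⟨a, c⟩ b
    -- Clearing the inverse avoids its formula in `Twisted`; what remains follows from `one_left`
    -- and `one_right`.
    refine mul_inv_eq_iff_eq_mul.2 (Prod.ext ?_ ((mul_one c).trans (one_mul c).symm))
    change a + M.ρ c (b - f (1, 1)) + f (c, 1) =
      M.ρ c b - f (1, 1) + M.ρ 1 a + f (1, c)
    rw [hf.one_left c, hf.one_right c, ρ_one a, map_sub]
    abel

theorem isFactorSet_opExt (hf : IsCocycle f) :
    hf.opExt.IsFactorSet (fun c => (show hf.Twisted from (0, c))) f where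
  γ_section _ := rfl
  mul_section c d := by
    refine Prod.ext ?_ (one_mul _).symm
    change 0 + M.ρ c 0 + f (c, d) = f (c, d) - f (1, 1) + M.ρ 1 0 + f (1, c * d)
    rw [hf.one_left (c * d), map_zero, map_zero]
    abel

end IsCocycle

end OpExt

end CohTwoGroup

namespace CohTwoGroup

/-! ### Butterflies from the unit crossed extension to itself -/

section UnitButterfly

variable {C : Type u} [Group C] {M : Rep.{u} ℤ C}

open CrossedExtension

namespace Butterfly

/-- The extension `ι, δ` underlying a butterfly that induces the identity on `M`. -/
def toOpExt (F : Butterfly (unit M) (unit M)) : OpExt M where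
  carrier := F.carrier
  ext :=
    { inl := F.ι
      rightHom := F.δ
      inl_injective := F.ι_injective
      range_inl_eq_ker_rightHom := Subgroup.ext fun f => (F.δ_eq_one_iff f).symm
      rightHom_surjective := F.δ_surjective }
  conj f b := by
    -- The map `p` of the unit crossed extension is the identity, so the two legs to `C` coincide
    -- and `ι_act` becomes the conjugation condition for `δ`.
    have h : F.δ f = F.γ f := F.p_δ f
    change _ = F.ι (modAct M (F.δ f) (Multiplicative.ofAdd b))
    rw [h]
    exact (F.ι_act f (Multiplicative.ofAdd b)).symm

/-- The identity of the central group works: `γ = δ` by `p_δ`, and `κ = -ι` because `j` is the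
identity and `β = 1`. This is the essential surjectivity of `Φ`. -/
theorem nonempty_iso_phiObj (F : Butterfly (unit M) (unit M)) (hF : F.beta = 𝟙 M) :
    Nonempty (Butterfly.Iso (phiObj F.toOpExt) F) := by
  refine ⟨⟨MulEquiv.refl _, fun _ => rfl, fun x => ?_, fun f => (F.p_δ f).symm, fun _ => rfl⟩⟩
  have h := F.beta_spec x.toAdd
  rw [hF] at h
  refine (map_inv F.ι x).trans ?_
  exact (eq_inv_of_mul_eq_one_left h).symm

end Butterfly

open Butterfly OpExt

theorem phiObj_congr {E E' : OpExt M} (f : E ⟶ E') : Nonempty (Butterfly.Iso (phiObj E) (phiObj E')) :=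
  ⟨((Phi M).map f).hom⟩

/-- Compatibility with `ι` and `δ` is all that a morphism of extensions asks for. -/
theorem hom_of_iso_phiObj {E E' : OpExt M} (f : Butterfly.Iso (phiObj E) (phiObj E')) : Nonempty (E ⟶ E') :=
  ⟨⟨f.equiv.toMonoidHom, f.equiv_ι, f.δ_equiv⟩⟩

/-- For these legs `⟨ι, κ'⟩` is the antidiagonal `b ↦ (κ b, κ' b⁻¹)`, so the centre of the composite
and the Baer sum are the same quotient of `E ×_C E'`. -/
theorem comp_phiObj (E E' : OpExt M) :
    Nonempty (Butterfly.Iso (comp (phiObj E) (phiObj E')) (phiObj (baer E E'))) := by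
  refine nonempty_iso_of (H := phiObj (baer E E')) (baerMk E E') (fun b => ?_) (fun b => rfl)
    (fun b => ?_) (fun x => x.2) (fun x => rfl)
  · exact baerMk_eq_one.2 ⟨b, rfl, rfl⟩
  -- The composite has the leg `b ↦ (κ b⁻¹, 1)`, the Baer sum has `b ↦ (1, κ' b⁻¹)`. The quotient of
  -- the second by the first is the antidiagonal element of `b`.
  · refine (compMk_eq (F := phiObj E) (G := phiObj E') (x := compInl _ _ b)
      (x' := inr E E' b⁻¹)).2 ⟨b, ?_, ?_⟩
    · change _ = (E.κ b⁻¹)⁻¹ * 1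
      rw [mul_one]
      exact ((congrArg Inv.inv (map_inv E.κ b)).trans (inv_inv (E.κ b))).symm
    · change _ = (1 : E'.carrier)⁻¹ * E'.κ b⁻¹
      rw [inv_one, one_mul]
      rfl

theorem phiObj_unit : Nonempty (Butterfly.Iso (phiObj (OpExt.unit M)) (Butterfly.id (unit M))) :=
  ⟨⟨MulEquiv.refl _, fun _ => rfl, fun _ => rfl, fun _ => one_mul _, fun _ => rfl⟩⟩

/-! ### From classes of extensions to automorphisms of the unit object -/

theorem toHom_eq_iff {E E' : CrossedExtension C} {F G : Butterfly E E'} :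
    F.toHom = G.toHom ↔ Nonempty (Butterfly.Iso F G) := Quotient.eq (r := Butterfly.setoid E E')

/-- The class of the butterfly of an extension, as an arrow of `[BExt](C)`. -/
def phiHom (x : Pi₀ M) : BExt.mk (unit M) ⟶ BExt.mk (unit M) :=
  Quotient.lift (fun E : OpExt M => (phiObj E).toHom)
    (fun _ _ h => by
      obtain ⟨f⟩ := zigzag_iff.1 h
      exact toHom_eq_iff.2 (phiObj_congr f)) x

theorem phiHom_injective : Function.Injective (phiHom (M := M)) := by
  rintro ⟨E⟩ ⟨E'⟩ h
  obtain ⟨f⟩ := toHom_eq_iff.1 h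
  exact mk_eq_of_hom (hom_of_iso_phiObj f)

theorem phiHom_add (x y : Pi₀ M) : phiHom (x + y) = phiHom x ≫ phiHom y := by
  obtain ⟨E⟩ := x
  obtain ⟨E'⟩ := y
  exact (toHom_eq_iff.2 (comp_phiObj E E')).symm

theorem phiHom_zero : phiHom (0 : Pi₀ M) = 𝟙 _ := toHom_eq_iff.2 phiObj_unit

theorem pbar_map_phiHom (x : Pi₀ M) : (PBar C).map (phiHom x) = 𝟙 M := by
  obtain ⟨E⟩ := x
  exact ((Phi M).obj E).property

theorem exists_phiHom_eq (φ : BExt.mk (unit M) ⟶ BExt.mk (unit M))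
    (h : (PBar C).map φ = 𝟙 M) : ∃ x : Pi₀ M, phiHom x = φ := by
  obtain ⟨F⟩ := φ
  exact ⟨CategoryTheory.ConnectedComponents.mk F.toOpExt, toHom_eq_iff.2 (F.nonempty_iso_phiObj h)⟩

/-- The endomorphism of the unit object given by an extension. -/
def phiFiber (x : Pi₀ M) : H3.unit M ⟶ H3.unit M :=
  ⟨phiHom x, IsHomLift.of_fac (p := PBar C) _ _ rfl rfl ((pbar_map_phiHom x).symm.trans
    ((Category.id_comp _).trans (Category.comp_id _)).symm)⟩

theorem phiFiber_add (x y : Pi₀ M) : phiFiber (x + y) = phiFiber x ≫ phiFiber y :=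
  Subtype.ext (phiHom_add x y)

theorem phiFiber_zero : phiFiber (0 : Pi₀ M) = 𝟙 _ := Subtype.ext phiHom_zero

/-- The automorphism of the unit object given by an extension. -/
def phiAut (x : Pi₀ M) : Pi₁ M where
  hom := phiFiber x
  inv := phiFiber (-x)
  hom_inv_id := by rw [← phiFiber_add, add_neg_cancel, phiFiber_zero]
  inv_hom_id := by rw [← phiFiber_add, neg_add_cancel, phiFiber_zero]

theorem phiAut_arrow (x : Pi₀ M) : (phiAut x).arrow = phiHom x := rfl

theorem Pi₁.arrow_injective : Function.Injective (Pi₁.arrow (M := M)) :=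
  fun _ _ h => Aut.ext (Subtype.ext h)

theorem Pi₁.pbar_map_arrow (a : Pi₁ M) : (PBar C).map a.arrow = 𝟙 M := by
  have : (PBar C).IsHomLift (𝟙 M) a.arrow := a.hom.2
  have h := IsHomLift.fac' (PBar C) (𝟙 M) a.arrow
  refine h.trans ?_
  exact (Category.id_comp _).trans (Category.comp_id _)

theorem phiAut_bijective : Function.Bijective (phiAut (M := M)) := by
  refine ⟨fun x y h => phiHom_injective (congrArg Pi₁.arrow h), fun a => ?_⟩
  obtain ⟨x, hx⟩ := exists_phiHom_eq a.arrow a.pbar_map_arrow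
  exact ⟨x, Pi₁.arrow_injective hx⟩

theorem phiAut_add (x y : Pi₀ M) : phiAut (x + y) = phiAut x * phiAut y := by
  -- Multiplication in `Aut` is composition in the reverse order: `a * b` has underlying arrow
  -- `b.hom ≫ a.hom`. Commutativity of the Baer sum absorbs the swap.
  rw [add_comm]
  exact Aut.ext (phiFiber_add y x)

variable (M) in
/-- The isomorphism between `π₀` of the 2-group of extensions and `π₁` of the third cohomology
2-group. -/
def phiEquiv : Pi₀ M ≃+ Additive (Pi₁ M) :=
  AddEquiv.mk' ((Equiv.ofBijective phiAut phiAut_bijective).trans Additive.ofMul) phiAut_add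

/-- Commutativity is transported from the Baer sum along the bijection `phiAut`. -/
theorem Pi₁.mul_comm (a b : Pi₁ M) : a * b = b * a := by
  obtain ⟨x, rfl⟩ := phiAut_bijective.2 a
  obtain ⟨y, rfl⟩ := phiAut_bijective.2 b
  rw [← phiAut_add, add_comm, phiAut_add]

/-! ### Connected components of `Eq(I)` -/

variable (M) in
theorem mapConnectedComponents_phi_bijective :
    Function.Bijective (Phi M).mapConnectedComponents := by
  constructor
  · rintro ⟨E⟩ ⟨E'⟩ h
    have hz : Zigzag ((Phi M).obj E) ((Phi M).obj E') := Quotient.exact h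
    have hi : Nonempty (Butterfly.Iso (phiObj E) (phiObj E')) := by
      -- Every arrow of `Eq(I)` is invertible, so a zigzag collapses to a single isomorphism. The
      -- endpoint `G` is left arbitrary because the objects in between need not be in the image of
      -- `Φ`.
      have key (G : EqI M) (hG : Zigzag ((Phi M).obj E) G) : Nonempty (Butterfly.Iso (phiObj E) G.obj) := by
        induction hG with
        | refl => exact ⟨𝟙 (phiObj E)⟩
        | tail _ h ih =>
          rcases h with ⟨⟨g⟩⟩ | ⟨⟨g⟩⟩
          · exact (setoid _ _).trans ih ⟨g.hom⟩
          · exact (setoid _ _).trans ih ⟨g.hom.symm⟩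
      exact key _ hz
    obtain ⟨f⟩ := hi
    exact mk_eq_of_hom (hom_of_iso_phiObj f)
  · rintro ⟨F⟩
    obtain ⟨f⟩ := F.obj.nonempty_iso_phiObj F.property
    exact ⟨CategoryTheory.ConnectedComponents.mk F.obj.toOpExt,
      Quotient.sound (s := Zigzag.setoid _) (Zigzag.of_hom (ObjectProperty.homMk f))⟩

variable (M) in
/-- The bijection from the isomorphism classes of `Eq(I)` to `π₁`. -/
def eqIEquiv : CategoryTheory.ConnectedComponents (EqI M) ≃ Pi₁ M :=
  (Equiv.ofBijective _ (mapConnectedComponents_phi_bijective M)).symm.trans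
    (Equiv.ofBijective phiAut phiAut_bijective)

theorem eqIEquiv_map (x : Pi₀ M) : eqIEquiv M ((Phi M).mapConnectedComponents x) = phiAut x :=
  congrArg phiAut
    ((Equiv.ofBijective _ (mapConnectedComponents_phi_bijective M)).symm_apply_apply x)

/-- `eqIEquiv` is defined through extensions; this identifies it with the map that takes a butterfly
to its isomorphism class, by replacing `F` with the isomorphic butterfly of `F.obj.toOpExt`. -/
theorem eqIEquiv_mk_arrow (F : EqI M) :
    (eqIEquiv M (CategoryTheory.ConnectedComponents.mk F)).arrow = F.obj.toHom := by
  obtain ⟨f⟩ := F.obj.nonempty_iso_phiObj F.property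
  have h : CategoryTheory.ConnectedComponents.mk F =
      (Phi M).mapConnectedComponents (CategoryTheory.ConnectedComponents.mk F.obj.toOpExt) :=
    (Quotient.sound (s := Zigzag.setoid _) (Zigzag.of_hom (ObjectProperty.homMk f))).symm
  rw [h, eqIEquiv_map, phiAut_arrow]
  exact toHom_eq_iff.2 ⟨f⟩

end UnitButterfly

end CohTwoGroup

namespace CohTwoGroup

/-! ### Extensions and the second cohomology group -/

namespace OpExt

variable {C : Type u} [Group C] {M : Rep.{u} ℤ C}

open groupCohomology

/-- Passing to `liftRep` changes only the scalars: the underlying set, addition and action are those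
of `M`, so cocycles and coboundaries are the same functions. -/
theorem mem_cocycles₂_liftRep {f : C × C → M} :
    f ∈ cocycles₂ (liftRep M) ↔ IsCocycle f := mem_cocycles₂_iff (A := liftRep M) f

theorem mem_coboundaries₂_liftRep {f : C × C → M} :
    f ∈ coboundaries₂ (liftRep M) ↔
      ∃ x : C → M, ∀ c d, M.ρ c (x d) - x (c * d) + x c = f (c, d) :=
  ⟨fun ⟨x, hx⟩ => ⟨x, fun c d => congrFun hx (c, d)⟩,
    fun ⟨x, hx⟩ => ⟨x, funext fun p => hx p.1 p.2⟩⟩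

/-- The cohomology class of a cocycle. -/
def cohClass (f : C × C → M) (hf : IsCocycle f) : CohTwoGroup.H2 M :=
  H2π (liftRep M) ⟨f, mem_cocycles₂_liftRep.2 hf⟩

theorem cohClass_eq_iff {f g : C × C → M} (hf : IsCocycle f) (hg : IsCocycle g) :
    cohClass f hf = cohClass g hg ↔
      ∃ x : C → M, ∀ c d, M.ρ c (x d) - x (c * d) + x c = f (c, d) - g (c, d) :=
  (H2π_eq_iff _ _).trans (mem_coboundaries₂_liftRep (f := f - g))

theorem cohClass_add {f g : C × C → M} (hf : IsCocycle f) (hg : IsCocycle g)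
    (hfg : IsCocycle fun p => f p + g p) :
    cohClass _ hfg = cohClass f hf + cohClass g hg :=
  map_add (H2π (liftRep M)).hom ⟨f, mem_cocycles₂_liftRep.2 hf⟩ ⟨g, mem_cocycles₂_liftRep.2 hg⟩

/-- The cohomology class of an extension. -/
def extClass (E : OpExt M) : CohTwoGroup.H2 M :=
  cohClass _ E.exists_isFactorSet.choose_spec.choose_spec.cocycle

/-- The class may be computed from any section, since `exists_coboundary` compares it with the
chosen one. -/
theorem IsFactorSet.extClass_eq {E : OpExt M} {s f} (h : E.IsFactorSet s f) :
    E.extClass = cohClass f h.cocycle := by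
  obtain ⟨x, hx⟩ := h.exists_coboundary E.exists_isFactorSet.choose_spec.choose_spec
  exact (cohClass_eq_iff _ _).2 ⟨x, fun c d => by rw [hx, add_sub_cancel_left]⟩

theorem extClass_eq_of_hom {E E' : OpExt M} (φ : E ⟶ E') : E.extClass = E'.extClass := by
  obtain ⟨s, f, h⟩ := E.exists_isFactorSet
  rw [h.extClass_eq, (h.map φ).extClass_eq]

/-- Cohomologous factor sets become equal after the section of `E'` is changed by the bounding
cochain, and then `nonempty_hom` applies. -/
theorem nonempty_hom_of_extClass_eq {E E' : OpExt M} (he : E.extClass = E'.extClass) :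
    Nonempty (E ⟶ E') := by
  obtain ⟨s, f, h⟩ := E.exists_isFactorSet
  obtain ⟨s', f', h'⟩ := E'.exists_isFactorSet
  rw [h.extClass_eq, h'.extClass_eq, cohClass_eq_iff] at he
  obtain ⟨x, hx⟩ := he
  have hf : (fun p => f' p + (M.ρ p.1 (x p.2) - x (p.1 * p.2) + x p.1)) = f :=
    funext fun p => by rw [hx, add_sub_cancel]
  exact h.nonempty_hom (hf ▸ h'.add_coboundary x)

theorem extClass_baer (E E' : OpExt M) : (baer E E').extClass = E.extClass + E'.extClass := by
  obtain ⟨s, f, h⟩ := E.exists_isFactorSet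
  obtain ⟨s', f', h'⟩ := E'.exists_isFactorSet
  rw [h.extClass_eq, h'.extClass_eq, (h.baer h').extClass_eq, cohClass_add h.cocycle h'.cocycle]

theorem extClass_surjective : Function.Surjective (extClass (M := M)) := by
  intro y
  induction y using H2_induction_on with
  | h f =>
    have hf : IsCocycle (M := M) f.1 := mem_cocycles₂_liftRep.1 f.2
    exact ⟨hf.opExt, hf.isFactorSet_opExt.extClass_eq⟩

end OpExt

variable {C : Type u} [Group C]

/-- The group of isomorphism classes of extensions is the second cohomology group. -/
def pi₀EquivH2 (M : Rep.{u} ℤ C) : Pi₀ M ≃+ H2 M :=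
  AddEquiv.mk'
    (Equiv.ofBijective
      (Quotient.lift OpExt.extClass fun _ _ h => by
        obtain ⟨f⟩ := OpExt.zigzag_iff.1 h
        exact OpExt.extClass_eq_of_hom f)
      ⟨by
        rintro ⟨E⟩ ⟨E'⟩ h
        exact mk_eq_of_hom (OpExt.nonempty_hom_of_extClass_eq h),
      fun y => by
        obtain ⟨E, hE⟩ := OpExt.extClass_surjective y
        exact ⟨CategoryTheory.ConnectedComponents.mk E, hE⟩⟩)
    (by
      rintro ⟨E⟩ ⟨E'⟩
      exact OpExt.extClass_baer E E')

end CohTwoGroup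

end

/-! ### The main theorem -/

theorem mainTheorem4 {C : Type u} [Group C] (M : Rep.{u} ℤ C) :
    (∀ a b : CohTwoGroup.Pi₁ M, a * b = b * a) ∧
    (∃ (t : CategoryTheory.ConnectedComponents (CohTwoGroup.EqI M) ≃ CohTwoGroup.Pi₁ M)
      (e : CohTwoGroup.Pi₀ M ≃+ Additive (CohTwoGroup.Pi₁ M)),
        (∀ F : CohTwoGroup.EqI M,
          (t (CategoryTheory.ConnectedComponents.mk F)).arrow = F.obj.toHom) ∧
        (∀ x : CohTwoGroup.Pi₀ M,
          (e x).toMul = t ((CohTwoGroup.Phi M).mapConnectedComponents x))) ∧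
    Nonempty (CohTwoGroup.Pi₀ M ≃+ CohTwoGroup.H2 M) ∧
    Nonempty (Additive (CohTwoGroup.Pi₁ M) ≃+ CohTwoGroup.H2 M) :=
  ⟨CohTwoGroup.Pi₁.mul_comm,
    ⟨CohTwoGroup.eqIEquiv M, CohTwoGroup.phiEquiv M, CohTwoGroup.eqIEquiv_mk_arrow,
      fun x => (CohTwoGroup.eqIEquiv_map x).symm⟩,
    ⟨CohTwoGroup.pi₀EquivH2 M⟩,
    ⟨(CohTwoGroup.phiEquiv M).symm.trans (CohTwoGroup.pi₀EquivH2 M)⟩⟩
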